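/- Let $d\ge 1$ and $[d+1]=\{1,\dots,d+1\}$. Let $\Pi_d\subset\mathbb R^{d+1}$ be the permutahedron, i.e. the convex hull of all $(\sigma(1),\dots,\sigma(d+1))$ for $\sigma\in\mathfrak S_{d+1}$, let $b$ be its barycenter, and let $V=\{x\in\mathbb R^{d+1}: x_1+\dots+x_{d+1}=0\}$, $\widetilde w_i=e_i-\frac1{d+1}\sum_j e_j$ and $w_i=(d+1)\widetilde w_i$. For a nonempty proper subset $A\subset[d+1]$ with complement $B$, let $[A,B]$ be the facet of $\Pi_d$ on which $\sum_{a\in A}x_a=1+\dots+|A|$. (1) The facet $[B,A]$ is opposite to $[A,B]$ (its reflection in $b$), and $[B,A]=[A,B]+\sum_{a\in A}w_a$. The quotient space of $\Pi_d$ obtained by identifying opposite facets by these translations, $x\sim x+\sum_{a\in A}w_a$ for $x\in[A,B]$, is homeomorphic to the $d$-dimensional torus $(S^1)^d$. (2) Let $k_1,\dots,k_{d+1}$ be positive integers and let $M_{\mathbf k}$ be the $(d+1)\times(d+1)$ matrix whose $i$-th row has the entry $k_i+1$ in column $i$, the entry $-k_{i+1}$ in column $i+1$ (indices cyclic modulo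 $d+1$), and zeros elsewhere. Let $\widetilde{\mathcal L}_{\mathbf k}$ be the group of all $\sum_j a_j\widetilde w_j$ with $(a_1,\dots,a_{d+1})$ an integer combination of the rows of $M_{\mathbf k}$, and let $\widetilde p_i=\sum_j (M_{\mathbf k})_{ij}\widetilde w_j$. Let $T_{\mathbf k}$ be the quotient complex obtained from the decomposition of $V$ by the affine hyperplanes $x_j-x_i=n$ ($1\le i<j\le d+1$, $n\in\mathbb Z$) by identifying faces that differ by a translation in $\widetilde{\mathcal L}_{\mathbf k}$; its underlying space is the corresponding quotient of $V$. Let $$P_{\mathbf k}=\tfrac1{d+1}\operatorname{conv}\{a_1\widetilde p_1+\dots+a_{d+1}\widetilde p_{d+1}:\{a_1,\dots,a_{d+1}\}=[d+1]\},$$ and let $[A,B]$ also denote the convex hull of those vertices $\frac1{d+1}\sum_i a_i\widetilde p_i$ of $P_{\mathbf k}$ for which $\{a_i\}_{i\in A}=\{1,\dots,|A|\}$. Then: (a) $P_{\mathbf k}$ is an affine image of $\Pi_d$: there is a linear automorphism $g$ of $V$ with $g(w_i)=\widetilde p_i$ for all $i$ such that the affine isomorphism $b+x\mapsto g(x)$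 $(x\in V)$ maps $\Pi_d$ onto $P_{\mathbf k}$ and, for every $A$, the facet $[A,B]$ of $\Pi_d$ onto the facet $[A,B]$ of $P_{\mathbf k}$. (b) $P_{\mathbf k}$ is a fundamental domain for $\widetilde{\mathcal L}_{\mathbf k}$ acting on $V$ by translations: it is the closure of its interior in $V$, its $\widetilde{\mathcal L}_{\mathbf k}$-translates cover $V$, and distinct translates have disjoint interiors. (c) For every $A$, $\sum_{i\in A}\widetilde p_i\in\widetilde{\mathcal L}_{\mathbf k}$ and $[B,A]=[A,B]+\sum_{i\in A}\widetilde p_i$ in $P_{\mathbf k}$. (d) The inclusion $P_{\mathbf k}\subset V$ induces a homeomorphism from $P_{\mathbf k}$ with opposite facets identified by these translations onto the underlying space of $T_{\mathbf k}$, and the latter is homeomorphic to $(S^1)^d$. -/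

import Mathlib

open scoped Pointwise

noncomputable section

namespace Permutahedron

/-! ### The permutahedron -/

/-- The vertex `(σ(1), …, σ(d+1))`; since `Fin (d+1)` starts at `0`, values are shifted by one. -/
def permVertex (d : ℕ) (σ : Equiv.Perm (Fin (d + 1))) : Fin (d + 1) → ℝ :=
  fun i => ((σ i : ℕ) : ℝ) + 1

/-- The permutahedron `Π_d`, the convex hull of all permutations of `[d+1]`. -/
def perm (d : ℕ) : Set (Fin (d + 1) → ℝ) :=
  convexHull ℝ (Set.range (permVertex d))

/-- The facet `[A, B]` of `Π_d` (`A` a nonempty proper subset of `[d+1]`, `B` its complement):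
the points of `Π_d` at which the facet inequality `∑_{a ∈ A} x_a ≥ 1 + … + |A|` is an equality. -/
def permFacet (d : ℕ) (A : Finset (Fin (d + 1))) : Set (Fin (d + 1) → ℝ) :=
  {x | x ∈ perm d ∧ ∑ a ∈ A, x a = ∑ j ∈ Finset.Icc 1 A.card, (j : ℝ)}

/-- The barycenter of `Π_d`. -/
def barycenter (d : ℕ) : Fin (d + 1) → ℝ :=
  fun _ => (∑ j ∈ Finset.Icc 1 (d + 1), (j : ℝ)) / (d + 1)

/-- The linear hyperplane `V = {x : x_1 + … + x_{d+1} = 0}`. -/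
def V (d : ℕ) : Submodule ℝ (Fin (d + 1) → ℝ) where
  carrier := {x | ∑ i, x i = 0}
  add_mem' := by
    intro x y hx hy
    simp only [Set.mem_ofPred_eq, Pi.add_apply, Finset.sum_add_distrib] at *
    rw [hx, hy, add_zero]
  zero_mem' := by simp
  smul_mem' := by
    intro c x hx
    simp only [Set.mem_ofPred_eq, Pi.smul_apply, smul_eq_mul] at *
    rw [← Finset.mul_sum, hx, mul_zero]

/-- The generator `w̃_i = e_i - (1/(d+1)) ∑_j e_j` of the weight lattice. -/
def wTilde (d : ℕ) (i : Fin (d + 1)) : V d :=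
  ⟨fun j => (if j = i then 1 else 0) - 1 / ((d : ℝ) + 1), by
    have h : (d : ℝ) + 1 ≠ 0 := by positivity
    change ∑ j, ((if j = i then (1 : ℝ) else 0) - 1 / ((d : ℝ) + 1)) = 0
    rw [Finset.sum_sub_distrib]
    simp [h]⟩

/-- `w_i = (d+1) w̃_i`, with `i`-th coordinate `d` and all other coordinates `-1`. -/
def w (d : ℕ) (i : Fin (d + 1)) : V d := ((d : ℝ) + 1) • wTilde d i

/-- The vector `∑_{a ∈ A} w_a` by which the facet `[A, B]` of `Π_d` is translated
onto the opposite facet `[B, A]`. -/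
def permShift (d : ℕ) (A : Finset (Fin (d + 1))) : Fin (d + 1) → ℝ :=
  ((∑ a ∈ A, w d a : V d) : Fin (d + 1) → ℝ)

/-! ### Identifying opposite facets -/

/-- Given a set `P` with subsets `F A` and vectors `t A` indexed by the nonempty proper subsets
`A` of `[d+1]`: the equivalence relation on `P` generated by identifying `x ∈ F A`
with `x + t A ∈ F Aᶜ`. -/
def facetSetoid {d : ℕ} {E : Type*} [Add E] (P : Set E)
    (F : Finset (Fin (d + 1)) → Set E) (t : Finset (Fin (d + 1)) → E) : Setoid P :=
  Relation.EqvGen.setoid fun x y : P =>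
    ∃ A : Finset (Fin (d + 1)), A.Nonempty ∧ A ≠ Finset.univ ∧
      (x : E) ∈ F A ∧ (y : E) ∈ F Aᶜ ∧ (y : E) = x + t A

/-- The permutahedron `Π_d` with opposite facets identified by translation
(with the quotient topology). -/
abbrev GluedPerm (d : ℕ) : Type :=
  Quotient (facetSetoid (perm d) (permFacet d) (permShift d))

/-! ### The sublattice and the torus `T_k` -/

/-- The matrix `M_k`: row `i` has `k_i + 1` in column `i` and `-k_{i+1}` in column `i+1`
(cyclically). -/
def M (d : ℕ) (k : Fin (d + 1) → ℕ) : Matrix (Fin (d + 1)) (Fin (d + 1)) ℤ :=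
  fun i j => (if j = i then (k i : ℤ) + 1 else 0) - (if j = i + 1 then (k j : ℤ) else 0)

/-- The lattice of all `∑ a_j w̃_j` with `a = b M_k` for some integer row vector `b`. -/
def sublattice (d : ℕ) (k : Fin (d + 1) → ℕ) : AddSubgroup (V d) where
  carrier := {v | ∃ b : Fin (d + 1) → ℤ, v = ∑ j, (Matrix.vecMul b (M d k) j) • wTilde d j}
  add_mem' := by
    rintro _ _ ⟨b, rfl⟩ ⟨c, rfl⟩
    exact ⟨b + c, by simp [Matrix.add_vecMul, add_smul, Finset.sum_add_distrib]⟩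
  zero_mem' := ⟨0, by simp⟩
  neg_mem' := by
    rintro _ ⟨b, rfl⟩
    exact ⟨-b, by simp [Matrix.neg_vecMul]⟩

/-- The closed face, containing `x` in its relative interior, of the decomposition of `V` by
the affine hyperplanes `x_j - x_i = n` (`i < j`, `n` an integer). -/
def affineFace (d : ℕ) (x : V d) : Set (V d) :=
  {y | ∀ i j : Fin (d + 1), i < j →
    (⌊x.1 j - x.1 i⌋ : ℝ) ≤ y.1 j - y.1 i ∧ y.1 j - y.1 i ≤ (⌈x.1 j - x.1 i⌉ : ℝ)}

/-- The set of nonempty faces of the infinite simplicial complex given by the affine Coxeter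
arrangement of type `Ã_d`. -/
def complexAffine (d : ℕ) : Set (Set (V d)) := Set.range (affineFace d)

/-- The equivalence relation on `V` (the union of all faces) generated by identifying, whenever
`F` and `F' = F + v` are faces with `v` in the sublattice, `x ∈ F` with `x + v ∈ F'`. -/
def torusSetoid (d : ℕ) (k : Fin (d + 1) → ℕ) : Setoid (V d) :=
  Relation.EqvGen.setoid fun x y : V d =>
    ∃ F ∈ complexAffine d, ∃ F' ∈ complexAffine d, ∃ v ∈ sublattice d k,
      F' = v +ᵥ F ∧ x ∈ F ∧ y = x + v

/-- The underlying topological space of the quotient complex `T_k`. -/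
abbrev TorusSpace (d : ℕ) (k : Fin (d + 1) → ℕ) : Type := Quotient (torusSetoid d k)

/-! ### The permutahedron domain of `T_k` -/

/-- `p̃_i = m_{i,1} w̃_1 + … + m_{i,d+1} w̃_{d+1}`, with `m` the matrix `M_k`. -/
def pTilde (d : ℕ) (k : Fin (d + 1) → ℕ) (i : Fin (d + 1)) : V d :=
  ∑ j, M d k i j • wTilde d j

/-- The point `(1/(d+1)) (a_1 p̃_1 + … + a_{d+1} p̃_{d+1})` for the permutation `a = σ` of `[d+1]`. -/
def domainVertex (d : ℕ) (k : Fin (d + 1) → ℕ) (σ : Equiv.Perm (Fin (d + 1))) : V d :=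
  (1 / ((d : ℝ) + 1)) • ∑ i, permVertex d σ i • pTilde d k i

/-- The permutahedron domain of `T_k`. -/
def domain (d : ℕ) (k : Fin (d + 1) → ℕ) : Set (V d) :=
  convexHull ℝ (Set.range (domainVertex d k))

/-- The facet `[A, B]` of the permutahedron domain: the convex hull of those vertices whose
coefficients satisfy `{a_i : i ∈ A} = {1, …, |A|}`. -/
def domainFacet (d : ℕ) (k : Fin (d + 1) → ℕ) (A : Finset (Fin (d + 1))) : Set (V d) :=
  convexHull ℝ (domainVertex d k ''
    {σ | A.image (fun i => (σ i : ℕ) + 1) = Finset.Icc 1 A.card})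

/-- The vector `∑_{a ∈ A} p̃_a`. -/
def domainShift (d : ℕ) (k : Fin (d + 1) → ℕ) (A : Finset (Fin (d + 1))) : V d :=
  ∑ a ∈ A, pTilde d k a

/-- The permutahedron domain with opposite facets identified by translation. -/
abbrev GluedDomain (d : ℕ) (k : Fin (d + 1) → ℕ) : Type :=
  Quotient (facetSetoid (domain d k) (domainFacet d k) (domainShift d k))

/-- `P` is a fundamental domain for the action of the subgroup `L` by translations: `P` is the
closure of its interior, its `L`-translates cover, and distinct `L`-translates have disjoint
interiors. -/
def IsFundamentalDomain {E : Type*} [AddGroup E] [TopologicalSpace E]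
    (L : AddSubgroup E) (P : Set E) : Prop :=
  closure (interior P) = P ∧ (∀ x : E, ∃ v ∈ L, x ∈ v +ᵥ P) ∧
    ∀ u ∈ L, ∀ v ∈ L, u ≠ v → Disjoint (interior (u +ᵥ P)) (interior (v +ᵥ P))

end Permutahedron

end

noncomputable section

namespace Permutahedron

/-! ### Coordinates in the hyperplane -/

/-! Translated to have barycenter 0, the permutahedron becomes `centeredPerm`, the Voronoi cell at
the origin of the lattice Λ ⊂ V generated by the w_i. Indeed, writing w_A for the sum of the w_a
over A, |y + w_A|² - |y|² = (d+1)(2 ∑_{a∈A} y_a + |A|(d+1-|A|)) (`sum_sq_add_sum_w`). So the facet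
inequality for A, available from Rado's description (`mem_perm_iff`), says precisely that y is no
longer than y + w_A.

Two facts carry everything. Subtracting a nearest lattice point moves any x into the cell
(`exists_sub_mem_centeredPerm`). Two points of the cell that differ by a lattice vector are equal or
are matched on opposite facets by some w_A (`sub_eq_zero_or_exists_facet`). Hence the cell is a
fundamental domain, and the map to (S¹)^d given by coordinates modulo Λ, restricted to the compact
cell, is a quotient map whose fibres are the classes of the facet gluing.

The statements about P_k are transported along the linear automorphism w_i ↦ p̃_i (`toPTilde`),
which takes Λ onto the sublattice and the centered permutahedron onto P_k, facet by facet. The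
relation defining T_k is just the orbit relation of the sublattice (`torusSetoid_iff`), so P_k with
glued facets and T_k are both identified with (S¹)^d through the same map `domainToTorus`. That
makes the homeomorphism between them the one induced by the inclusion. -/

theorem mem_V {d : ℕ} (x : V d) : ∑ i, x.1 i = 0 := x.2

theorem coe_sum_V {d : ℕ} {ι : Type*} (s : Finset ι) (f : ι → V d) (j : Fin (d + 1)) :
    (∑ i ∈ s, f i : V d).1 j = ∑ i ∈ s, (f i).1 j := by
  rw [Submodule.coe_sum, Finset.sum_apply]

theorem sum_smul_wTilde_apply {d : ℕ} (a : Fin (d + 1) → ℝ) (j : Fin (d + 1)) :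
    (∑ i, a i • wTilde d i : V d).1 j = a j - (∑ i, a i) / ((d : ℝ) + 1) := by
  rw [coe_sum_V]
  simp [wTilde, mul_sub, Finset.sum_sub_distrib, ← Finset.sum_mul, div_eq_mul_inv]

theorem sum_smul_w_apply {d : ℕ} (a : Fin (d + 1) → ℝ) (j : Fin (d + 1)) :
    (∑ i, a i • w d i : V d).1 j = ((d : ℝ) + 1) * a j - ∑ i, a i := by
  have h : (d : ℝ) + 1 ≠ 0 := by positivity
  have : (∑ i, a i • w d i : V d) = ((d : ℝ) + 1) • ∑ i, a i • wTilde d i := by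
    simp only [w, Finset.smul_sum]
    exact Finset.sum_congr rfl fun i _ => smul_comm _ _ _
  rw [this]
  change ((d : ℝ) + 1) * (∑ i, a i • wTilde d i : V d).1 j = _
  rw [sum_smul_wTilde_apply]
  field_simp

theorem sum_w_eq_sum_smul {d : ℕ} (A : Finset (Fin (d + 1))) :
    ∑ a ∈ A, w d a = ∑ i, (if i ∈ A then (1 : ℝ) else 0) • w d i := by
  simp [ite_smul]

theorem sum_w_apply {d : ℕ} (A : Finset (Fin (d + 1))) (j : Fin (d + 1)) :
    (∑ a ∈ A, w d a : V d).1 j = (if j ∈ A then (d : ℝ) + 1 else 0) - A.card := by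
  rw [sum_w_eq_sum_smul, sum_smul_w_apply]
  simp

theorem sum_w_compl {d : ℕ} (A : Finset (Fin (d + 1))) :
    ∑ a ∈ Aᶜ, w d a = -∑ a ∈ A, w d a := by
  ext j
  change _ = -(∑ a ∈ A, w d a : V d).1 j
  rw [sum_w_apply, sum_w_apply, Finset.card_compl, Fintype.card_fin,
    Nat.cast_sub (by simpa using A.card_le_univ)]
  by_cases h : j ∈ A <;> simp [h]

/-! ### Sums of distinct positive integers -/

theorem sum_Icc_one_cast (m : ℕ) : ∑ j ∈ Finset.Icc 1 m, (j : ℝ) = m * (m + 1) / 2 := by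
  induction m with
  | zero => simp
  | succ m ih =>
    rw [Finset.sum_Icc_succ_top (by omega), ih]
    push_cast
    ring

/-- Exchange argument: elements of s beyond |s| are at least |s|+1, the missing elements of
{1,…,|s|} are at most |s|, and there are equally many of both. The extra summand on the left settles
the equality case. -/
theorem sum_Icc_add_card_sdiff_le (s : Finset ℕ) (hs : ∀ x ∈ s, 1 ≤ x) :
    ∑ j ∈ Finset.Icc 1 s.card, j + (s \ Finset.Icc 1 s.card).card ≤ ∑ j ∈ s, j := by
  set I := Finset.Icc 1 s.card with hI
  have hcard : (s \ I).card = (I \ s).card := Finset.card_sdiff_comm (by simp [hI])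
  have h1 := Finset.sum_inter_add_sum_sdiff s I (fun j => j)
  have h2 := Finset.sum_inter_add_sum_sdiff I s (fun j => j)
  rw [Finset.inter_comm] at h2
  have h3 : (s \ I).card • (s.card + 1) ≤ ∑ j ∈ s \ I, j := by
    refine Finset.card_nsmul_le_sum _ _ _ fun x hx => ?_
    simp only [hI, Finset.mem_sdiff, Finset.mem_Icc] at hx
    have := hs x hx.1
    omega
  have h4 : ∑ j ∈ I \ s, j ≤ (I \ s).card • s.card := by
    refine Finset.sum_le_card_nsmul _ _ _ fun x hx => ?_
    simp only [hI, Finset.mem_sdiff, Finset.mem_Icc] at hx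
    omega
  rw [← hcard] at h4
  simp only [smul_eq_mul] at h3 h4
  linarith

theorem sum_permVertex_eq {d : ℕ} (σ : Equiv.Perm (Fin (d + 1))) (A : Finset (Fin (d + 1))) :
    ∑ a ∈ A, permVertex d σ a =
      ((∑ j ∈ A.image (fun i => (σ i : ℕ) + 1), j : ℕ) : ℝ) := by
  rw [Finset.sum_image]
  · push_cast
    rfl
  · intro x _ y _ h
    exact σ.injective (Fin.ext (by simpa using h))

theorem card_image_perm {d : ℕ} (σ : Equiv.Perm (Fin (d + 1))) (A : Finset (Fin (d + 1))) :
    (A.image (fun i => (σ i : ℕ) + 1)).card = A.card :=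
  Finset.card_image_of_injective _ fun x y h => σ.injective (Fin.ext (by simpa using h))

theorem le_sum_permVertex {d : ℕ} (σ : Equiv.Perm (Fin (d + 1))) (A : Finset (Fin (d + 1))) :
    ∑ j ∈ Finset.Icc 1 A.card, (j : ℝ) ≤ ∑ a ∈ A, permVertex d σ a := by
  have h := sum_Icc_add_card_sdiff_le (A.image (fun i => (σ i : ℕ) + 1)) (by simp)
  rw [card_image_perm] at h
  rw [sum_permVertex_eq, ← Nat.cast_sum, Nat.cast_le]
  exact le_trans (Nat.le_add_right _ _) h

theorem sum_permVertex_eq_iff {d : ℕ} (σ : Equiv.Perm (Fin (d + 1))) (A : Finset (Fin (d + 1))) :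
    ∑ a ∈ A, permVertex d σ a = ∑ j ∈ Finset.Icc 1 A.card, (j : ℝ) ↔
      A.image (fun i => (σ i : ℕ) + 1) = Finset.Icc 1 A.card := by
  rw [sum_permVertex_eq, ← Nat.cast_sum, Nat.cast_inj]
  constructor
  · intro heq'
    have h := sum_Icc_add_card_sdiff_le (A.image (fun i => (σ i : ℕ) + 1)) (by simp)
    rw [card_image_perm, heq'] at h
    have h0 : (A.image (fun i => (σ i : ℕ) + 1) \ Finset.Icc 1 A.card).card = 0 := by omega
    rw [Finset.card_eq_zero, Finset.sdiff_eq_empty_iff_subset] at h0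
    exact Finset.eq_of_subset_of_card_le h0 (by rw [card_image_perm]; simp)
  · intro h
    rw [h]

theorem sum_univ_permVertex {d : ℕ} (σ : Equiv.Perm (Fin (d + 1))) :
    ∑ i, permVertex d σ i = ∑ j ∈ Finset.Icc 1 (d + 1), (j : ℝ) := by
  have h := (sum_permVertex_eq_iff σ Finset.univ).2
  rw [Finset.card_univ, Fintype.card_fin] at h
  refine h (Finset.eq_of_subset_of_card_le ?_ ?_)
  · intro x hx
    simp only [Finset.mem_image, Finset.mem_univ, true_and] at hx
    obtain ⟨i, rfl⟩ := hx
    simp only [Finset.mem_Icc]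
    omega
  · rw [card_image_perm]
    simp

theorem image_eq_Icc_iff {d : ℕ} (σ : Equiv.Perm (Fin (d + 1))) (A : Finset (Fin (d + 1))) :
    A.image (fun i => (σ i : ℕ) + 1) = Finset.Icc 1 A.card ↔ ∀ i, i ∈ A ↔ (σ i : ℕ) < A.card := by
  constructor
  · intro h i
    constructor
    · intro hi
      have : (σ i : ℕ) + 1 ∈ Finset.Icc 1 A.card := h ▸ Finset.mem_image_of_mem _ hi
      simp only [Finset.mem_Icc] at this
      omega
    · intro hi
      have : (σ i : ℕ) + 1 ∈ A.image (fun i => (σ i : ℕ) + 1) := by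
        rw [h, Finset.mem_Icc]
        omega
      obtain ⟨j, hj, hji⟩ := Finset.mem_image.1 this
      have : j = i := σ.injective (Fin.ext (by simpa using hji))
      exact this ▸ hj
  · intro h
    refine Finset.eq_of_subset_of_card_le ?_ (by rw [card_image_perm]; simp)
    intro x hx
    obtain ⟨i, hi, rfl⟩ := Finset.mem_image.1 hx
    have := (h i).1 hi
    simp only [Finset.mem_Icc]
    omega

/-! ### The permutahedron by inequalities -/

/-- Abel summation, done by induction on the length of the partial sum. -/
theorem sum_range_mul_le {γ z : ℕ → ℝ} (hγ : Monotone γ) {n : ℕ}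
    (hz : ∀ m ≤ n, 0 ≤ ∑ i ∈ Finset.range m, z i) :
    ∀ m < n, ∑ i ∈ Finset.range (m + 1), γ i * z i ≤ γ m * ∑ i ∈ Finset.range (m + 1), z i := by
  intro m
  induction m with
  | zero => intro _; simp
  | succ m ih =>
    intro hm
    have h1 := ih (by omega)
    have h2 : γ m * ∑ i ∈ Finset.range (m + 1), z i ≤
        γ (m + 1) * ∑ i ∈ Finset.range (m + 1), z i :=
      mul_le_mul_of_nonneg_right (hγ (Nat.le_succ m)) (hz _ (by omega))
    rw [Finset.sum_range_succ, Finset.sum_range_succ z, mul_add]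
    linarith

theorem sum_mul_nonpos_of_monotone {d : ℕ} {γ z : Fin (d + 1) → ℝ} (hγ : Monotone γ)
    (hz : ∀ m : ℕ, 0 ≤ ∑ i : Fin (d + 1) with i.val < m, z i) (h0 : ∑ i, z i = 0) :
    ∑ i, γ i * z i ≤ 0 := by
  -- γ is continued by its last value, which keeps it monotone on ℕ; z is continued by 0.
  let γ' : ℕ → ℝ := fun i => γ ⟨min i d, by omega⟩
  let z' : ℕ → ℝ := fun i => if h : i < d + 1 then z ⟨i, h⟩ else 0
  have hγ' : Monotone γ' := fun a b hab => hγ (by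
    rw [Fin.mk_le_mk]
    exact min_le_min_right _ hab)
  have hz' : ∀ i : Fin (d + 1), z' i = z i := fun i => dif_pos i.2
  have hγz : ∀ i : Fin (d + 1), γ' i = γ i := fun i => by
    simp only [γ']
    congr 1
    exact Fin.ext (by simp; omega)
  have hpre : ∀ m ≤ d + 1, ∑ i ∈ Finset.range m, z' i = ∑ i : Fin (d + 1) with i.val < m, z i := by
    intro m hm
    rw [Finset.sum_filter]
    simp only [← hz']
    rw [Fin.sum_univ_eq_sum_range (fun i => if i < m then z' i else 0), ← Finset.sum_filter]
    refine Finset.sum_congr ?_ fun _ _ => rfl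
    ext i
    simp only [Finset.mem_range, Finset.mem_filter]
    omega
  have key := sum_range_mul_le hγ' (z := z') (n := d + 1)
    (fun m hm => by rw [hpre m hm]; exact hz m) d (by omega)
  have e1 : ∑ i ∈ Finset.range (d + 1), γ' i * z' i = ∑ i, γ i * z i := by
    rw [← Fin.sum_univ_eq_sum_range (fun i => γ' i * z' i)]
    exact Finset.sum_congr rfl fun i _ => by rw [hz', hγz]
  have e2 : ∑ i ∈ Finset.range (d + 1), z' i = 0 := by
    rw [← Fin.sum_univ_eq_sum_range z', ← h0]
    exact Finset.sum_congr rfl fun i _ => hz' i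
  rwa [e1, e2, mul_zero] at key

/-- Rado's theorem. For the hard direction, a point outside the hull is separated from it by a
functional c. The vertex ordered like c maximizes c over the hull, and Abel summation shows that the
inequalities prevent x from exceeding it. -/
theorem mem_perm_iff {d : ℕ} (x : Fin (d + 1) → ℝ) :
    x ∈ perm d ↔ ∑ i, x i = ∑ j ∈ Finset.Icc 1 (d + 1), (j : ℝ) ∧
      ∀ A : Finset (Fin (d + 1)), ∑ j ∈ Finset.Icc 1 A.card, (j : ℝ) ≤ ∑ a ∈ A, x a := by
  constructor
  · intro hx
    have hlin : ∀ A : Finset (Fin (d + 1)),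
        IsLinearMap ℝ fun x : Fin (d + 1) → ℝ => ∑ a ∈ A, x a := fun A =>
      ⟨fun x y => by simp [Finset.sum_add_distrib], fun c x => by simp [Finset.mul_sum]⟩
    constructor
    · refine convexHull_min (t := {x | ∑ i, x i = ∑ j ∈ Finset.Icc 1 (d + 1), (j : ℝ)}) ?_
        (convex_hyperplane (hlin Finset.univ) _) hx
      rintro _ ⟨σ, rfl⟩
      exact sum_univ_permVertex σ
    · intro A
      refine convexHull_min (t := {x | ∑ j ∈ Finset.Icc 1 A.card, (j : ℝ) ≤ ∑ a ∈ A, x a}) ?_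
        (convex_halfSpace_ge (hlin A) _) hx
      rintro _ ⟨σ, rfl⟩
      exact le_sum_permVertex σ A
  · rintro ⟨htot, hA⟩
    by_contra hx
    obtain ⟨f, u, hf, hu⟩ := geometric_hahn_banach_closed_point
      (convex_convexHull ℝ (Set.range (permVertex d)))
      ((Set.finite_range (permVertex d)).isClosed_convexHull ℝ) hx
    set c : Fin (d + 1) → ℝ := fun i => f (Pi.single i 1) with hc
    have hfc : ∀ y : Fin (d + 1) → ℝ, f y = ∑ i, c i * y i := by
      intro y
      have h := LinearMap.pi_apply_eq_sum_univ (f : (Fin (d + 1) → ℝ) →ₗ[ℝ] ℝ) y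
      change f y = _ at h
      rw [h]
      refine Finset.sum_congr rfl fun i _ => ?_
      rw [smul_eq_mul, mul_comm]
      congr 1
      refine congrArg f (funext fun j => ?_)
      simp [Pi.single_apply, eq_comm]
    set π := Tuple.sort c
    have hmono : Monotone (c ∘ π) := Tuple.monotone_sort c
    -- π sorts c increasingly, so π⁻¹ gives each index its rank: larger values stand where c is
    -- larger.
    have hv := hf _ (subset_convexHull ℝ _ ⟨π⁻¹, rfl⟩)
    have key := sum_mul_nonpos_of_monotone (γ := c ∘ π)
      (z := fun i => x (π i) - permVertex d π⁻¹ (π i)) hmono ?_ ?_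
    · simp only [Function.comp_apply] at key
      rw [Equiv.sum_comp π (fun i => c i * (x i - permVertex d π⁻¹ i))] at key
      simp only [mul_sub, Finset.sum_sub_distrib] at key
      rw [hfc] at hv hu
      linarith
    · intro m
      set S : Finset (Fin (d + 1)) := Finset.univ.filter (fun i : Fin (d + 1) => (i : ℕ) < m)
      have h1 : ∑ i ∈ S, x (π i) = ∑ a ∈ S.map π.toEmbedding, x a := by simp
      have h2 : ∑ i ∈ S, permVertex d π⁻¹ (π i) =
          ∑ a ∈ S.map π.toEmbedding, permVertex d π⁻¹ a := by simp
      -- The first m indices in sorted order carry the smallest values of the vertex, so its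
      -- inequality for this set is tight; this makes the partial sums of x minus the vertex
      -- nonnegative.
      have h3 : ∑ a ∈ S.map π.toEmbedding, permVertex d π⁻¹ a =
          ∑ j ∈ Finset.Icc 1 (S.map π.toEmbedding).card, (j : ℝ) := by
        rw [sum_permVertex_eq_iff, image_eq_Icc_iff]
        have hcard : S.card = min m (d + 1) := by
          have : S.card = ((Finset.range (d + 1)).filter (· < m)).card := by
            simp only [S, Finset.card_filter]
            exact Fin.sum_univ_eq_sum_range (fun i => if i < m then 1 else 0) (d + 1)
          rw [this, ← Finset.card_range (min m (d + 1))]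
          congr 1
          ext i
          simp
          omega
        intro i
        rw [Finset.card_map, hcard]
        have : i ∈ S.map π.toEmbedding ↔ π⁻¹ i ∈ S := by
          rw [Finset.mem_map_equiv]
          rfl
        rw [this]
        simp only [S, Finset.mem_filter, Finset.mem_univ, true_and]
        omega
      rw [Finset.sum_sub_distrib, h1, h2, h3]
      exact sub_nonneg.2 (hA _)
    · rw [Finset.sum_sub_distrib, Equiv.sum_comp π x, Equiv.sum_comp π (permVertex d π⁻¹), htot,
        sum_univ_permVertex, sub_self]

/-! ### Faces of convex hulls -/

/-- The points strictly above the supporting hyperplane, together with the hull of the generators on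
it, form a convex set containing S: a proper convex combination reaches the hyperplane only if both
endpoints lie on it. -/
theorem mem_convexHull_inter_hyperplane {E : Type*} [AddCommGroup E] [Module ℝ E] (l : E →ₗ[ℝ] ℝ)
    {S : Set E} {c : ℝ} (hS : ∀ x ∈ S, c ≤ l x) {x : E} (hx : x ∈ convexHull ℝ S) (hl : l x = c) :
    x ∈ convexHull ℝ (S ∩ {y | l y = c}) := by
  let H := convexHull ℝ (S ∩ {y | l y = c})
  have hH : ∀ y ∈ H, l y = c := fun y hy =>
    convexHull_min (t := {y | l y = c}) Set.inter_subset_right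
      (convex_hyperplane l.isLinear _) hy
  have hT : Convex ℝ {y | c < l y ∨ y ∈ H} := by
    intro y hy z hz a b ha hb hab
    have hy' : c ≤ l y := hy.elim le_of_lt fun h => (hH y h).ge
    have hz' : c ≤ l z := hz.elim le_of_lt fun h => (hH z h).ge
    rcases ha.eq_or_lt with rfl | ha
    · obtain rfl : b = 1 := by linarith
      simpa using hz
    rcases hb.eq_or_lt with rfl | hb
    · obtain rfl : a = 1 := by linarith
      simpa using hy
    have hc : c = a * c + b * c := by rw [← add_mul, hab, one_mul]
    rcases hy with hy | hy
    · left
      rw [map_add, map_smul, map_smul, smul_eq_mul, smul_eq_mul]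
      nlinarith [mul_lt_mul_of_pos_left hy ha, mul_le_mul_of_nonneg_left hz' hb.le]
    rcases hz with hz | hz
    · left
      rw [map_add, map_smul, map_smul, smul_eq_mul, smul_eq_mul]
      nlinarith [mul_lt_mul_of_pos_left hz hb, mul_le_mul_of_nonneg_left hy' ha.le]
    · exact Or.inr (convex_convexHull ℝ _ hy hz ha.le hb.le hab)
  have hsub : S ⊆ {y | c < l y ∨ y ∈ H} := fun y hy =>
    (hS y hy).lt_or_eq.imp id fun h => subset_convexHull ℝ _ ⟨hy, h.symm⟩
  rcases convexHull_min hsub hT hx with h | h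
  · exact absurd hl h.ne'
  · exact h

theorem permFacet_eq_convexHull (d : ℕ) (A : Finset (Fin (d + 1))) :
    permFacet d A = convexHull ℝ (permVertex d ''
      {σ | A.image (fun i => (σ i : ℕ) + 1) = Finset.Icc 1 A.card}) := by
  let l : (Fin (d + 1) → ℝ) →ₗ[ℝ] ℝ := ∑ a ∈ A, LinearMap.proj a
  have hl : ∀ x, l x = ∑ a ∈ A, x a := fun x => by simp [l]
  have hset : Set.range (permVertex d) ∩ {y | l y = ∑ j ∈ Finset.Icc 1 A.card, (j : ℝ)} =
      permVertex d '' {σ | A.image (fun i => (σ i : ℕ) + 1) = Finset.Icc 1 A.card} := by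
    ext x
    constructor
    · rintro ⟨⟨σ, rfl⟩, h⟩
      exact ⟨σ, (sum_permVertex_eq_iff σ A).1 ((hl _).symm.trans h), rfl⟩
    · rintro ⟨σ, h, rfl⟩
      exact ⟨⟨σ, rfl⟩, (hl _).trans ((sum_permVertex_eq_iff σ A).2 h)⟩
  rw [← hset]
  ext x
  constructor
  · rintro ⟨hx, hA⟩
    refine mem_convexHull_inter_hyperplane l ?_ hx ((hl x).trans hA)
    rintro _ ⟨σ, rfl⟩
    rw [hl]
    exact le_sum_permVertex σ A
  · intro hx
    refine ⟨convexHull_mono Set.inter_subset_left hx, ?_⟩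
    rw [← hl]
    exact convexHull_min (t := {y | l y = ∑ j ∈ Finset.Icc 1 A.card, (j : ℝ)})
      Set.inter_subset_right (convex_hyperplane l.isLinear _) hx

/-! ### The centered permutahedron -/

/-- The vertex of `Π_d` given by `σ`, translated into the hyperplane `V`. -/
def centeredVertex (d : ℕ) (σ : Equiv.Perm (Fin (d + 1))) : V d :=
  ∑ i, permVertex d σ i • wTilde d i

/-- The translate of `Π_d` in `V` with barycenter `0`. -/
def centeredPerm (d : ℕ) : Set (V d) := convexHull ℝ (Set.range (centeredVertex d))

/-- The facet `[A, B]` of the centered permutahedron. -/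
def centeredFacet (d : ℕ) (A : Finset (Fin (d + 1))) : Set (V d) :=
  convexHull ℝ (centeredVertex d '' {σ | A.image (fun i => (σ i : ℕ) + 1) = Finset.Icc 1 A.card})

/-- The translation `x ↦ b + x` from `V` to the affine hyperplane spanned by `Π_d`. -/
def addBarycenter (d : ℕ) : V d →ᵃ[ℝ] (Fin (d + 1) → ℝ) :=
  AffineMap.const ℝ (V d) (barycenter d) + (V d).subtype.toAffineMap

theorem addBarycenter_apply {d : ℕ} (x : V d) : addBarycenter d x = barycenter d + x.1 := rfl

theorem addBarycenter_injective (d : ℕ) : Function.Injective (addBarycenter d) := by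
  intro x y h
  rw [addBarycenter_apply, addBarycenter_apply] at h
  exact Subtype.ext (add_left_cancel h)

theorem barycenter_apply (d : ℕ) (i : Fin (d + 1)) : barycenter d i = ((d : ℝ) + 2) / 2 := by
  have h : (d : ℝ) + 1 ≠ 0 := by positivity
  rw [barycenter, sum_Icc_one_cast]
  push_cast
  field_simp
  ring

theorem centeredVertex_apply {d : ℕ} (σ : Equiv.Perm (Fin (d + 1))) (j : Fin (d + 1)) :
    (centeredVertex d σ).1 j = permVertex d σ j - ((d : ℝ) + 2) / 2 := by
  rw [centeredVertex, sum_smul_wTilde_apply, sum_univ_permVertex, ← barycenter_apply d j]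
  rfl

theorem addBarycenter_centeredVertex {d : ℕ} (σ : Equiv.Perm (Fin (d + 1))) :
    addBarycenter d (centeredVertex d σ) = permVertex d σ := by
  ext j
  rw [addBarycenter_apply, Pi.add_apply, centeredVertex_apply, barycenter_apply]
  ring

theorem addBarycenter_image_centeredPerm (d : ℕ) :
    addBarycenter d '' centeredPerm d = perm d := by
  rw [centeredPerm, AffineMap.image_convexHull, ← Set.range_comp, perm]
  congr 2
  exact funext addBarycenter_centeredVertex

theorem addBarycenter_image_centeredFacet (d : ℕ) (A : Finset (Fin (d + 1))) :
    addBarycenter d '' centeredFacet d A = permFacet d A := by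
  rw [centeredFacet, AffineMap.image_convexHull, ← Set.image_comp, permFacet_eq_convexHull]
  congr 2
  exact funext addBarycenter_centeredVertex

theorem sum_addBarycenter {d : ℕ} (x : V d) (A : Finset (Fin (d + 1))) :
    ∑ a ∈ A, addBarycenter d x a = A.card * (((d : ℝ) + 2) / 2) + ∑ a ∈ A, x.1 a := by
  simp [addBarycenter_apply, Finset.sum_add_distrib, barycenter_apply]

/-- The bound is 1+…+|A| minus |A| times the barycenter coordinate (d+2)/2. The equation for the
total sum is automatic in V. -/
theorem mem_centeredPerm_iff {d : ℕ} (x : V d) :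
    x ∈ centeredPerm d ↔ ∀ A : Finset (Fin (d + 1)),
      -((A.card : ℝ) * ((d : ℝ) + 1 - A.card) / 2) ≤ ∑ a ∈ A, x.1 a := by
  rw [← (addBarycenter_injective d).mem_set_image, addBarycenter_image_centeredPerm, mem_perm_iff]
  have h : ∀ A : Finset (Fin (d + 1)),
      (∑ j ∈ Finset.Icc 1 A.card, (j : ℝ) ≤ ∑ a ∈ A, addBarycenter d x a ↔
        -((A.card : ℝ) * ((d : ℝ) + 1 - A.card) / 2) ≤ ∑ a ∈ A, x.1 a) := fun A => by
    rw [sum_addBarycenter, sum_Icc_one_cast]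
    constructor <;> intro h <;> linarith
  simp only [h]
  refine and_iff_right ?_
  rw [sum_addBarycenter, mem_V, sum_Icc_one_cast, Finset.card_univ, Fintype.card_fin]
  push_cast
  ring

theorem mem_centeredFacet_iff {d : ℕ} (x : V d) (A : Finset (Fin (d + 1))) :
    x ∈ centeredFacet d A ↔ x ∈ centeredPerm d ∧
      ∑ a ∈ A, x.1 a = -((A.card : ℝ) * ((d : ℝ) + 1 - A.card) / 2) := by
  rw [← (addBarycenter_injective d).mem_set_image, addBarycenter_image_centeredFacet,
    ← (addBarycenter_injective d).mem_set_image (s := centeredPerm d),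
    addBarycenter_image_centeredPerm]
  change _ ∧ _ ↔ _
  rw [sum_addBarycenter, sum_Icc_one_cast]
  refine and_congr_right fun _ => ?_
  constructor <;> intro h <;> linarith

theorem isCompact_centeredPerm (d : ℕ) : IsCompact (centeredPerm d) :=
  (Set.finite_range _).isCompact_convexHull ℝ

theorem convex_centeredPerm (d : ℕ) : Convex ℝ (centeredPerm d) := convex_convexHull ℝ _

/-! ### Opposite facets -/

/-- Adding w_A raises the entries on A by d+1-|A| and lowers the others by |A|. When A carries the
|A| smallest values, this is a cyclic shift of the values modulo d+1. -/
theorem exists_centeredVertex_add {d : ℕ} {A : Finset (Fin (d + 1))} (hA : A.Nonempty)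
    {σ : Equiv.Perm (Fin (d + 1))}
    (hσ : A.image (fun i => (σ i : ℕ) + 1) = Finset.Icc 1 A.card) :
    ∃ τ : Equiv.Perm (Fin (d + 1)),
      Aᶜ.image (fun i => (τ i : ℕ) + 1) = Finset.Icc 1 Aᶜ.card ∧
      centeredVertex d σ + ∑ a ∈ A, w d a = centeredVertex d τ := by
  rw [image_eq_Icc_iff] at hσ
  have hpos : 0 < A.card := hA.card_pos
  have hle : A.card ≤ d + 1 := by simpa using A.card_le_univ
  let c : Fin (d + 1) := ⟨d + 1 - A.card, by omega⟩
  let τ : Equiv.Perm (Fin (d + 1)) := σ.trans (Equiv.addRight c)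
  have hτ : ∀ i, (τ i : ℕ) = ((σ i : ℕ) + (d + 1 - A.card)) % (d + 1) := fun i => by
    change ((σ i + c : Fin (d + 1)) : ℕ) = _
    rw [Fin.val_add]
  have hin : ∀ i, i ∈ A → (τ i : ℕ) = (σ i : ℕ) + (d + 1 - A.card) := fun i hi => by
    have := (hσ i).1 hi
    rw [hτ, Nat.mod_eq_of_lt (by omega)]
  have hout : ∀ i, i ∉ A → (τ i : ℕ) + A.card = (σ i : ℕ) := fun i hi => by
    have h1 : A.card ≤ (σ i : ℕ) := not_lt.1 fun h => hi ((hσ i).2 h)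
    have h2 := (σ i).2
    rw [hτ, Nat.mod_eq_sub_mod (by omega), Nat.mod_eq_of_lt (by omega)]
    omega
  refine ⟨τ, ?_, ?_⟩
  · rw [image_eq_Icc_iff]
    intro i
    rw [Finset.mem_compl, Finset.card_compl, Fintype.card_fin]
    by_cases hi : i ∈ A
    · have := hin i hi
      simp only [hi, not_true_eq_false, false_iff]
      omega
    · have := hout i hi
      have h2 := (σ i).2
      simp only [hi, not_false_eq_true, true_iff]
      omega
  · ext j
    change (centeredVertex d σ).1 j + (∑ a ∈ A, w d a : V d).1 j = (centeredVertex d τ).1 j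
    rw [centeredVertex_apply, centeredVertex_apply, sum_w_apply, permVertex, permVertex]
    by_cases hj : j ∈ A
    · rw [hin j hj, if_pos hj, Nat.cast_add, Nat.cast_sub hle]
      push_cast
      ring
    · rw [← hout j hj, if_neg hj]
      push_cast
      ring

theorem add_mem_centeredFacet_compl {d : ℕ} {A : Finset (Fin (d + 1))} (hA : A.Nonempty)
    {x : V d} (hx : x ∈ centeredFacet d A) : x + ∑ a ∈ A, w d a ∈ centeredFacet d Aᶜ := by
  refine convexHull_min (t := (fun y => y + ∑ a ∈ A, w d a) ⁻¹' centeredFacet d Aᶜ) ?_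
    (Convex.translate_preimage_left (convex_convexHull ℝ _) _) hx
  rintro _ ⟨σ, hσ, rfl⟩
  obtain ⟨τ, hτ, h⟩ := exists_centeredVertex_add hA hσ
  exact subset_convexHull ℝ _ ⟨τ, hτ, h.symm⟩

theorem compl_nonempty_of_ne_univ {d : ℕ} {A : Finset (Fin (d + 1))} (hA : A ≠ Finset.univ) :
    Aᶜ.Nonempty := by
  rwa [Finset.nonempty_iff_ne_empty, Ne, Finset.compl_eq_empty_iff]

/-- The w_i sum to 0, so the shift for the complement is the inverse translation; one inclusion,
applied to A and to its complement, suffices. -/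
theorem centeredFacet_compl {d : ℕ} {A : Finset (Fin (d + 1))} (hA : A.Nonempty)
    (hA' : A ≠ Finset.univ) :
    centeredFacet d Aᶜ = (fun x => x + ∑ a ∈ A, w d a) '' centeredFacet d A := by
  ext x
  constructor
  · intro hx
    have h := add_mem_centeredFacet_compl (compl_nonempty_of_ne_univ hA') hx
    rw [compl_compl] at h
    exact ⟨_, h, by simp [sum_w_compl]⟩
  · rintro ⟨y, hy, rfl⟩
    exact add_mem_centeredFacet_compl hA hy

theorem neg_centeredVertex {d : ℕ} (σ : Equiv.Perm (Fin (d + 1))) :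
    -centeredVertex d σ = centeredVertex d (σ.trans Fin.revPerm) := by
  ext j
  change -(centeredVertex d σ).1 j = (centeredVertex d _).1 j
  rw [centeredVertex_apply, centeredVertex_apply, permVertex, permVertex]
  have h : (((σ.trans Fin.revPerm) j : Fin (d + 1)) : ℕ) + (σ j : ℕ) = d := by
    simp only [Equiv.trans_apply, Fin.revPerm_apply, Fin.val_rev]
    omega
  have h' : ((((σ.trans Fin.revPerm) j : Fin (d + 1)) : ℕ) : ℝ) + ((σ j : ℕ) : ℝ) = d := by
    exact_mod_cast h
  linarith

theorem neg_mem_centeredPerm {d : ℕ} {x : V d} (hx : x ∈ centeredPerm d) :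
    -x ∈ centeredPerm d := by
  refine convexHull_min (t := (fun y => -y) ⁻¹' centeredPerm d) ?_
    ((convex_centeredPerm d).is_linear_preimage (IsLinearMap.isLinearMap_neg)) hx
  rintro _ ⟨σ, rfl⟩
  exact subset_convexHull ℝ _ ⟨_, (neg_centeredVertex σ).symm⟩

theorem sum_compl_eq_neg {d : ℕ} (x : V d) (A : Finset (Fin (d + 1))) :
    ∑ a ∈ Aᶜ, x.1 a = -∑ a ∈ A, x.1 a := by
  have := Finset.sum_add_sum_compl A x.1
  rw [mem_V] at this
  linarith

theorem cast_card_compl {d : ℕ} (A : Finset (Fin (d + 1))) :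
    (Aᶜ.card : ℝ) = (d : ℝ) + 1 - A.card := by
  rw [Finset.card_compl, Fintype.card_fin, Nat.cast_sub (by simpa using A.card_le_univ)]
  push_cast
  ring

theorem neg_mem_centeredFacet_compl {d : ℕ} {A : Finset (Fin (d + 1))}
    {x : V d} (hx : x ∈ centeredFacet d A) : -x ∈ centeredFacet d Aᶜ := by
  rw [mem_centeredFacet_iff] at hx ⊢
  refine ⟨neg_mem_centeredPerm hx.1, ?_⟩
  rw [sum_compl_eq_neg, cast_card_compl]
  have : ∑ a ∈ A, (-x : V d).1 a = -∑ a ∈ A, x.1 a := by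
    rw [← Finset.sum_neg_distrib]
    rfl
  rw [this, hx.2]
  ring

theorem centeredFacet_compl_eq_neg {d : ℕ} (A : Finset (Fin (d + 1))) :
    centeredFacet d Aᶜ = (fun x => -x) '' centeredFacet d A := by
  ext x
  constructor
  · intro hx
    have h := neg_mem_centeredFacet_compl hx
    rw [compl_compl] at h
    exact ⟨_, h, neg_neg x⟩
  · rintro ⟨y, hy, rfl⟩
    exact neg_mem_centeredFacet_compl hy

/-! ### The lattice generated by the vectors `w_i` -/

/-- The lattice generated by `w_1, …, w_{d+1}`. -/
def wLattice (d : ℕ) : AddSubgroup (V d) where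
  carrier := {v | ∃ m : Fin (d + 1) → ℤ, v = ∑ i, (m i : ℝ) • w d i}
  add_mem' := by
    rintro _ _ ⟨m, rfl⟩ ⟨m', rfl⟩
    exact ⟨m + m', by simp [add_smul, Finset.sum_add_distrib]⟩
  zero_mem' := ⟨0, by simp⟩
  neg_mem' := by
    rintro _ ⟨m, rfl⟩
    refine ⟨-m, ?_⟩
    rw [neg_eq_iff_add_eq_zero, ← Finset.sum_add_distrib]
    exact Finset.sum_eq_zero fun i _ => by
      rw [← add_smul, Pi.neg_apply, Int.cast_neg, add_neg_cancel, zero_smul]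

theorem sum_w_mem_wLattice {d : ℕ} (A : Finset (Fin (d + 1))) :
    ∑ a ∈ A, w d a ∈ wLattice d :=
  ⟨fun i => if i ∈ A then 1 else 0, by
    rw [sum_w_eq_sum_smul]
    exact Finset.sum_congr rfl fun i _ => by push_cast; rfl⟩

theorem sum_sq_add_sum_w {d : ℕ} (y : V d) (A : Finset (Fin (d + 1))) :
    ∑ j, (y.1 j + ((if j ∈ A then (d : ℝ) + 1 else 0) - A.card)) ^ 2 =
      ∑ j, y.1 j ^ 2 + 2 * ((d : ℝ) + 1) * ∑ a ∈ A, y.1 a +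
        ((d : ℝ) + 1) * (A.card * ((d : ℝ) + 1 - A.card)) := by
  have h : ∀ j, (y.1 j + ((if j ∈ A then (d : ℝ) + 1 else 0) - A.card)) ^ 2 =
      y.1 j ^ 2 + 2 * ((d : ℝ) + 1) * (if j ∈ A then y.1 j else 0) - 2 * A.card * y.1 j +
        (((d : ℝ) + 1) * ((d : ℝ) + 1 - 2 * A.card)) * (if j ∈ A then 1 else 0) +
          (A.card : ℝ) ^ 2 := fun j => by
    split_ifs <;> ring
  simp only [h, Finset.sum_add_distrib, Finset.sum_sub_distrib, ← Finset.mul_sum, mem_V]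
  simp
  ring

theorem exists_sub_mem_centeredPerm {d : ℕ} (x : V d) :
    ∃ v ∈ wLattice d, x - v ∈ centeredPerm d := by
  let f : (Fin (d + 1) → ℤ) → ℝ := fun z => ∑ j, (x.1 j - z j) ^ 2
  -- S is the lattice in coordinates. Its points are integral, so only finitely many are at least as
  -- close to x as 0 is, and a nearest one exists.
  let S : Set (Fin (d + 1) → ℤ) := {z | ∃ m : Fin (d + 1) → ℤ, ∀ j, z j = (d + 1) * m j - ∑ i, m i}
  have hfin : (S ∩ {z | f z ≤ f 0}).Finite := by
    refine (Set.finite_Icc (fun j => ⌊x.1 j - √(f 0)⌋) (fun j => ⌈x.1 j + √(f 0)⌉)).subset ?_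
    rintro z ⟨-, hz⟩
    have hj : ∀ j, |x.1 j - z j| ≤ √(f 0) := fun j =>
      Real.abs_le_sqrt (le_trans (Finset.single_le_sum (f := fun j => (x.1 j - z j) ^ 2)
        (fun i _ => sq_nonneg _) (Finset.mem_univ j)) hz)
    constructor <;> intro j <;> have := abs_le.1 (hj j)
    · have h : (⌊x.1 j - √(f 0)⌋ : ℝ) ≤ z j := (Int.floor_le _).trans (by linarith)
      exact_mod_cast h
    · have h : (z j : ℝ) ≤ (⌈x.1 j + √(f 0)⌉ : ℝ) := le_trans (by linarith) (Int.le_ceil _)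
      exact_mod_cast h
  obtain ⟨z, ⟨⟨m, hm⟩, hz0⟩, hmin⟩ := Set.exists_min_image _ f hfin ⟨0, ⟨0, by simp⟩, le_refl (f 0)⟩
  have hmin' : ∀ z' ∈ S, f z ≤ f z' := fun z' hz' =>
    (le_total (f z') (f 0)).elim (fun h => hmin z' ⟨hz', h⟩) fun h => le_trans hz0 h
  refine ⟨_, ⟨m, rfl⟩, ?_⟩
  set y := x - ∑ i, (m i : ℝ) • w d i with hy
  have hyj : ∀ j, y.1 j = x.1 j - z j := fun j => by
    change x.1 j - (∑ i, (m i : ℝ) • w d i : V d).1 j = _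
    rw [sum_smul_w_apply, hm]
    push_cast
    ring
  rw [mem_centeredPerm_iff]
  intro A
  -- The competitor is the lattice point z - w_A; by the norm expansion, its not being closer to x
  -- is the facet inequality for A.
  have h1 := hmin' (fun j => z j - ((if j ∈ A then (d : ℤ) + 1 else 0) - A.card))
    ⟨fun j => m j - if j ∈ A then 1 else 0, fun j => by
      dsimp only
      rw [hm, Finset.sum_sub_distrib]
      by_cases hj : j ∈ A <;> simp [hj] <;> ring⟩
  have h2 : f (fun j => z j - ((if j ∈ A then (d : ℤ) + 1 else 0) - A.card)) =
      ∑ j, (y.1 j + ((if j ∈ A then (d : ℝ) + 1 else 0) - A.card)) ^ 2 := by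
    refine Finset.sum_congr rfl fun j _ => ?_
    rw [hyj]
    push_cast
    ring
  have h3 : f z = ∑ j, y.1 j ^ 2 := Finset.sum_congr rfl fun j _ => by rw [hyj]
  rw [h2, h3, sum_sq_add_sum_w] at h1
  have hd : (0 : ℝ) < (d : ℝ) + 1 := by positivity
  have h4 : 0 ≤ ((d : ℝ) + 1) * (2 * ∑ a ∈ A, y.1 a + A.card * ((d : ℝ) + 1 - A.card)) := by
    linarith
  have h5 := nonneg_of_mul_nonneg_right h4 hd
  linarith

/-- Write y - x = ∑ m_i w_i and let A be the set where m is maximal. The facet bounds for x on A and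
for y on the complement limit the growth of the sum over A to |A|(d+1-|A|). As m drops by at least 1
off A, the growth is at least that, so m drops by exactly 1, y - x = w_A, and both bounds are tight.
-/
theorem sub_eq_zero_or_exists_facet {d : ℕ} {x y : V d} (hx : x ∈ centeredPerm d)
    (hy : y ∈ centeredPerm d) (hxy : y - x ∈ wLattice d) :
    y = x ∨ ∃ A : Finset (Fin (d + 1)), A.Nonempty ∧ A ≠ Finset.univ ∧
      x ∈ centeredFacet d A ∧ y ∈ centeredFacet d Aᶜ ∧ y = x + ∑ a ∈ A, w d a := by
  obtain ⟨m, hm⟩ := hxy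
  obtain ⟨i₀, hi₀⟩ := Finite.exists_max m
  set A : Finset (Fin (d + 1)) := Finset.univ.filter fun i => m i = m i₀ with hA
  have hmemA : ∀ i, i ∈ A ↔ m i = m i₀ := fun i => by simp [hA]
  have hAne : A.Nonempty := ⟨i₀, by simp [hA]⟩
  have hyx : ∀ j, y.1 j = x.1 j + (((d : ℝ) + 1) * m j - ∑ i, (m i : ℝ)) := fun j => by
    rw [← sum_smul_w_apply (fun i => (m i : ℝ)) j, ← hm]
    change _ = x.1 j + (y.1 j - x.1 j)
    ring
  have hpos : (0 : ℝ) < A.card := by exact_mod_cast hAne.card_pos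
  have hsum : ∑ a ∈ A, y.1 a =
      ∑ a ∈ A, x.1 a + A.card * (((d : ℝ) + 1) * m i₀ - ∑ i, (m i : ℝ)) := by
    simp only [hyx, Finset.sum_add_distrib]
    congr 1
    rw [← nsmul_eq_mul, ← Finset.sum_const]
    exact Finset.sum_congr rfl fun a ha => by rw [(hmemA a).1 ha]
  have hlow := (mem_centeredPerm_iff x).1 hx A
  have hup := (mem_centeredPerm_iff y).1 hy Aᶜ
  rw [sum_compl_eq_neg, cast_card_compl] at hup
  -- The excess of the drop of m over its least possible value, 0 on A and 1 off A; it is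
  -- nonnegative, and the facet bounds make its sum at most 0.
  let t : Fin (d + 1) → ℤ := fun i => m i₀ - m i - if i ∈ A then 0 else 1
  have ht0 : ∀ i, 0 ≤ t i := fun i => by
    have h1 := hi₀ i
    by_cases hi : i ∈ A
    · simp only [t, if_pos hi]
      omega
    · have h2 : m i ≠ m i₀ := fun h => hi ((hmemA i).2 h)
      simp only [t, if_neg hi]
      omega
  have hone : ∑ i, (if i ∈ A then (0 : ℝ) else 1) = (d : ℝ) + 1 - A.card := by
    rw [← cast_card_compl, ← Finset.sum_add_sum_compl A, Finset.sum_congr rfl fun i hi => if_pos hi,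
      Finset.sum_congr rfl fun i hi => if_neg (Finset.mem_compl.1 hi)]
    simp
  have hsumt : ((∑ i, t i : ℤ) : ℝ) =
      ((d : ℝ) + 1) * m i₀ - ∑ i, (m i : ℝ) - ((d : ℝ) + 1 - A.card) := by
    rw [← hone]
    simp [t, Finset.sum_sub_distrib]
  have hle : ((∑ i, t i : ℤ) : ℝ) ≤ 0 := by
    rw [hsumt]
    by_contra hcon
    have := mul_pos hpos (not_le.1 hcon)
    linarith
  have hsum0 : ∑ i, t i = 0 := le_antisymm (by exact_mod_cast hle)
    (Finset.sum_nonneg fun i _ => ht0 i)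
  have ht : ∀ i, t i = 0 := fun i =>
    (Finset.sum_eq_zero_iff_of_nonneg fun i _ => ht0 i).1 hsum0 i (Finset.mem_univ i)
  have hdiff : ((d : ℝ) + 1) * m i₀ - ∑ i, (m i : ℝ) = (d : ℝ) + 1 - A.card := by
    rw [hsum0, Int.cast_zero] at hsumt
    linarith
  have hy' : y = x + ∑ a ∈ A, w d a := by
    ext j
    change y.1 j = x.1 j + (∑ a ∈ A, w d a : V d).1 j
    rw [hyx, sum_w_apply]
    have hj : (m j : ℝ) = m i₀ - if j ∈ A then 0 else 1 := by
      have h1 : m j = m i₀ - if j ∈ A then 0 else 1 := by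
        have := ht j
        simp only [t] at this
        omega
      rw [h1]
      push_cast
      rfl
    rw [hj]
    split_ifs <;> linarith
  by_cases hAu : A = Finset.univ
  · left
    -- Here m is constant, and the w_i sum to 0.
    rw [hy', hAu]
    have : ∑ a, w d a = 0 := by
      ext j
      rw [sum_w_apply]
      simp
    rw [this, add_zero]
  · right
    have hxF : x ∈ centeredFacet d A := by
      rw [mem_centeredFacet_iff]
      refine ⟨hx, le_antisymm ?_ hlow⟩
      rw [hsum, hdiff] at hup
      linarith
    exact ⟨A, hAne, hAu, hxF, hy' ▸ add_mem_centeredFacet_compl hAne hxF, hy'⟩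

theorem card_mul_pos {d : ℕ} {A : Finset (Fin (d + 1))} (hA : A.Nonempty)
    (hA' : A ≠ Finset.univ) : (0 : ℝ) < A.card * ((d : ℝ) + 1 - A.card) := by
  rw [← cast_card_compl]
  have h1 := hA.card_pos
  have h2 := (compl_nonempty_of_ne_univ hA').card_pos
  positivity

/-- A small step along -w_A stays in the cell and lowers the sum over A, so the bound was not tight.
-/
theorem lt_sum_of_mem_interior {d : ℕ} {x : V d} (hx : x ∈ interior (centeredPerm d))
    {A : Finset (Fin (d + 1))} (hA : A.Nonempty) (hA' : A ≠ Finset.univ) :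
    -((A.card : ℝ) * ((d : ℝ) + 1 - A.card) / 2) < ∑ a ∈ A, x.1 a := by
  have hcont : Continuous fun ε : ℝ => x - ε • ∑ a ∈ A, w d a := by fun_prop
  have hnhds : (fun ε : ℝ => x - ε • ∑ a ∈ A, w d a) ⁻¹' interior (centeredPerm d) ∈ nhds 0 :=
    (isOpen_interior.preimage hcont).mem_nhds (by simpa using hx)
  obtain ⟨δ, hδ, hball⟩ := Metric.mem_nhds_iff.1 hnhds
  have hε : δ / 2 ∈ Metric.ball (0 : ℝ) δ := by
    rw [Metric.mem_ball, dist_zero_right, Real.norm_of_nonneg (by positivity)]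
    linarith
  have h := (mem_centeredPerm_iff _).1 (interior_subset (hball hε)) A
  have hs : ∑ a ∈ A, (x - (δ / 2) • ∑ a ∈ A, w d a : V d).1 a =
      ∑ a ∈ A, x.1 a - (δ / 2) * (A.card * ((d : ℝ) + 1 - A.card)) := by
    rw [← nsmul_eq_mul A.card, ← Finset.sum_const, Finset.mul_sum, ← Finset.sum_sub_distrib]
    refine Finset.sum_congr rfl fun a ha => ?_
    change x.1 a - (δ / 2) * (∑ a ∈ A, w d a : V d).1 a = _
    rw [sum_w_apply, if_pos ha]
  rw [hs] at h
  have := mul_pos (half_pos hδ) (card_mul_pos hA hA')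
  linarith

theorem zero_mem_interior_centeredPerm (d : ℕ) : (0 : V d) ∈ interior (centeredPerm d) := by
  let U : Set (V d) := ⋂ A : {A : Finset (Fin (d + 1)) // A.Nonempty ∧ A ≠ Finset.univ},
    {x | -((A.1.card : ℝ) * ((d : ℝ) + 1 - A.1.card) / 2) < ∑ a ∈ A.1, x.1 a}
  have hU : IsOpen U := isOpen_iInter_of_finite fun A => by
    refine isOpen_lt continuous_const (continuous_finsetSum _ fun a _ => ?_)
    exact (continuous_apply a).comp continuous_subtype_val
  refine mem_interior.2 ⟨U, fun x hx => ?_, hU, ?_⟩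
  · rw [mem_centeredPerm_iff]
    intro A
    by_cases hA : A.Nonempty
    · by_cases hA' : A = Finset.univ
      · subst hA'
        rw [mem_V]
        simp
      · exact (Set.mem_iInter.1 hx ⟨A, hA, hA'⟩).le
    · rw [Finset.not_nonempty_iff_eq_empty] at hA
      simp [hA]
  · refine Set.mem_iInter.2 fun A => ?_
    have := card_mul_pos A.2.1 A.2.2
    simp only [Set.mem_ofPred_eq, ZeroMemClass.coe_zero, Pi.zero_apply, Finset.sum_const_zero]
    linarith

theorem isFundamentalDomain_centeredPerm (d : ℕ) :
    IsFundamentalDomain (wLattice d) (centeredPerm d) := by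
  refine ⟨?_, fun x => ?_, fun u hu v hv huv => ?_⟩
  · rw [(convex_centeredPerm d).closure_interior_eq_closure_of_nonempty_interior
      ⟨0, zero_mem_interior_centeredPerm d⟩, (isCompact_centeredPerm d).isClosed.closure_eq]
  · obtain ⟨v, hv, hxv⟩ := exists_sub_mem_centeredPerm x
    exact ⟨v, hv, x - v, hxv, by simp⟩
  · rw [interior_vadd, interior_vadd, Set.disjoint_left]
    rintro _ ⟨p, hp, rfl⟩ ⟨q, hq, hqp⟩
    simp only [vadd_eq_add] at hqp
    have hqp' : q - p = u - v := by
      rw [sub_eq_sub_iff_add_eq_add, add_comm q]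
      exact hqp
    rcases sub_eq_zero_or_exists_facet (interior_subset hp) (interior_subset hq)
      (hqp' ▸ (wLattice d).sub_mem hu hv) with h | ⟨A, hA, hA', hpF, -, -⟩
    · rw [h, sub_self] at hqp'
      exact huv (sub_eq_zero.1 hqp'.symm)
    · exact (lt_sum_of_mem_interior hp hA hA').ne' ((mem_centeredFacet_iff p A).1 hpF).2

/-! ### The torus -/

/-- The homeomorphism from a quotient to `Y` given by a quotient map with the right fibres. -/
theorem exists_homeomorph_quotient {X Y : Type*} [TopologicalSpace X] [TopologicalSpace Y]
    (s : Setoid X) {f : X → Y} (hf : Topology.IsQuotientMap f)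
    (hs : ∀ x y, s x y ↔ f x = f y) :
    ∃ h : Quotient s ≃ₜ Y, ∀ x, h (Quotient.mk s x) = f x := by
  obtain rfl : s = Setoid.ker f := Setoid.ext hs
  exact ⟨Topology.IsQuotientMap.homeomorph (f := ⟨f, hf.continuous⟩) hf, fun x => rfl⟩

/-- The map from `ℝ^{d+1}` to the torus that takes the coordinates with respect to
`w_1, …, w_d`, modulo `1`. -/
def toTorus (d : ℕ) (x : Fin (d + 1) → ℝ) : Fin d → Circle := fun i =>
  Circle.exp (2 * Real.pi * ((x i.castSucc - x (Fin.last d)) / ((d : ℝ) + 1)))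

theorem continuous_toTorus (d : ℕ) : Continuous (toTorus d) :=
  continuous_pi fun _ => Circle.exp.continuous.comp (by fun_prop)

theorem toTorus_addBarycenter {d : ℕ} (x : V d) : toTorus d (addBarycenter d x) = toTorus d x.1 := by
  funext i
  simp only [toTorus, addBarycenter_apply, Pi.add_apply, barycenter_apply, add_sub_add_left_eq_sub]

theorem toTorus_eq_iff {d : ℕ} (x y : V d) :
    toTorus d x.1 = toTorus d y.1 ↔ y - x ∈ wLattice d := by
  have hd : (d : ℝ) + 1 ≠ 0 := by positivity
  have hpi := Real.pi_ne_zero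
  have key : ∀ i : Fin d, ∀ n : ℤ,
      2 * Real.pi * ((y.1 i.castSucc - y.1 (Fin.last d)) / ((d : ℝ) + 1)) =
        2 * Real.pi * ((x.1 i.castSucc - x.1 (Fin.last d)) / ((d : ℝ) + 1)) + n * (2 * Real.pi) ↔
      (y - x : V d).1 i.castSucc = (y - x : V d).1 (Fin.last d) + ((d : ℝ) + 1) * n := by
    intro i n
    change _ ↔ y.1 i.castSucc - x.1 i.castSucc =
      y.1 (Fin.last d) - x.1 (Fin.last d) + ((d : ℝ) + 1) * n
    field_simp
    constructor <;> intro h <;> linarith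
  rw [eq_comm]
  constructor
  · intro h
    have h' : ∀ i : Fin d, ∃ n : ℤ,
        (y - x : V d).1 i.castSucc = (y - x : V d).1 (Fin.last d) + ((d : ℝ) + 1) * n := fun i => by
      obtain ⟨n, hn⟩ := Circle.exp_eq_exp.1 (congrFun h i)
      exact ⟨n, (key i n).1 hn⟩
    choose n hn using h'
    -- Since the w_i sum to 0, the last coefficient can be normalized to 0.
    refine ⟨Fin.snoc n 0, ?_⟩
    have h0 := mem_V (y - x)
    rw [Fin.sum_univ_castSucc] at h0
    simp only [hn, Finset.sum_add_distrib, ← Finset.mul_sum, Finset.sum_const, Finset.card_univ,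
      Fintype.card_fin, nsmul_eq_mul] at h0
    have hlast : (y - x : V d).1 (Fin.last d) = -∑ i, (n i : ℝ) := by
      have : ((d : ℝ) + 1) * ((y - x : V d).1 (Fin.last d) + ∑ i, (n i : ℝ)) = 0 := by
        linarith
      linarith [(mul_eq_zero.1 this).resolve_left hd]
    ext j
    rw [sum_smul_w_apply, Fin.sum_univ_castSucc]
    simp only [Fin.snoc_castSucc, Fin.snoc_last]
    refine Fin.lastCases ?_ (fun i => ?_) j
    · rw [hlast]
      simp
    · rw [hn, hlast]
      simp
      ring
  · rintro ⟨m, hm⟩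
    funext i
    refine Circle.exp_eq_exp.2 ⟨m i.castSucc - m (Fin.last d), (key i _).2 ?_⟩
    rw [hm, sum_smul_w_apply, sum_smul_w_apply]
    push_cast
    ring

theorem surjective_toTorus (d : ℕ) : Function.Surjective fun x : V d => toTorus d x.1 := by
  intro θ
  choose t ht using fun i => Circle.exp_surjective (θ i)
  have hd : (d : ℝ) + 1 ≠ 0 := by positivity
  refine ⟨∑ i, (Fin.snoc (fun i => t i / (2 * Real.pi)) 0 : Fin (d + 1) → ℝ) i • w d i, ?_⟩
  funext i
  rw [← ht i]
  simp only [toTorus, sum_smul_w_apply, Fin.snoc_castSucc, Fin.snoc_last]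
  congr 1
  have := Real.pi_ne_zero
  field_simp
  ring

theorem exists_mem_centeredPerm_toTorus_eq {d : ℕ} (θ : Fin d → Circle) :
    ∃ x ∈ centeredPerm d, toTorus d x.1 = θ := by
  obtain ⟨x, rfl⟩ := surjective_toTorus d θ
  obtain ⟨v, hv, hx⟩ := exists_sub_mem_centeredPerm x
  exact ⟨x - v, hx, (toTorus_eq_iff _ _).2 (by simpa using hv)⟩

theorem isQuotientMap_of_isCompact {X Y : Type*} [TopologicalSpace X] [TopologicalSpace Y]
    [T2Space Y] {P : Set X} (hP : IsCompact P) {f : X → Y} (hf : Continuous f)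
    (hsurj : ∀ y, ∃ x ∈ P, f x = y) : Topology.IsQuotientMap fun x : P => f x := by
  have := isCompact_iff_compactSpace.1 hP
  have hc : Continuous fun x : P => f x := hf.comp continuous_subtype_val
  refine hc.isClosedMap.isQuotientMap hc fun y => ?_
  obtain ⟨x, hx, h⟩ := hsurj y
  exact ⟨⟨x, hx⟩, h⟩

/-! ### Gluing opposite facets -/

/-- Points of P with the same image are equal or related by a single generator, so the generated
equivalence needs no chains. -/
theorem facetSetoid_iff {d : ℕ} {E Y : Type*} [Add E] {P : Set E}
    {F : Finset (Fin (d + 1)) → Set E} {t : Finset (Fin (d + 1)) → E} {f : E → Y}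
    (hf : ∀ x A, f (x + t A) = f x)
    (h : ∀ x ∈ P, ∀ y ∈ P, f x = f y → y = x ∨ ∃ A : Finset (Fin (d + 1)), A.Nonempty ∧
      A ≠ Finset.univ ∧ x ∈ F A ∧ y ∈ F Aᶜ ∧ y = x + t A) (x y : P) :
    facetSetoid P F t x y ↔ f x = f y := by
  constructor
  · intro hxy
    have hle : facetSetoid P F t ≤ Setoid.ker fun x : P => f x := by
      refine Setoid.eqvGen_le ?_
      rintro x y ⟨A, -, -, -, -, hxy⟩
      change f x = f y
      rw [hxy, hf]
    exact hle hxy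
  · intro hxy
    rcases h x x.2 y y.2 hxy with h | ⟨A, h⟩
    · rw [Subtype.ext h]
    · exact Relation.EqvGen.rel _ _ ⟨A, h⟩

/-! ### The linear automorphism taking `w_i` to `p̃_i` -/

theorem M_sum_mul {d : ℕ} (k : Fin (d + 1) → ℕ) (y : Fin (d + 1) → ℝ) (j : Fin (d + 1)) :
    ∑ i, y i * (M d k i j : ℝ) = y j * ((k j : ℝ) + 1) - y (j - 1) * k j := by
  have h : ∀ i, y i * (M d k i j : ℝ) =
      (if j = i then y i * ((k i : ℝ) + 1) else 0) - (if j - 1 = i then y i * k j else 0) := by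
    intro i
    simp only [M, ← sub_eq_iff_eq_add]
    push_cast
    rw [mul_sub, mul_ite, mul_ite, mul_zero]
  simp only [h, Finset.sum_sub_distrib, Finset.sum_ite_eq, Finset.mem_univ, if_true]

theorem sum_smul_pTilde {d : ℕ} (k : Fin (d + 1) → ℕ) (y : Fin (d + 1) → ℝ) :
    ∑ i, y i • pTilde d k i =
      ∑ j, (y j * ((k j : ℝ) + 1) - y (j - 1) * k j) • wTilde d j := by
  simp only [pTilde, Finset.smul_sum]
  rw [Finset.sum_comm]
  refine Finset.sum_congr rfl fun j _ => ?_
  rw [← M_sum_mul, Finset.sum_smul]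
  refine Finset.sum_congr rfl fun i _ => ?_
  rw [mul_smul, Int.cast_smul_eq_zsmul]

theorem sum_pTilde {d : ℕ} (k : Fin (d + 1) → ℕ) : ∑ i, pTilde d k i = 0 := by
  have h := sum_smul_pTilde k 1
  simp only [Pi.one_apply, one_smul] at h
  rw [h]
  ext j
  rw [sum_smul_wTilde_apply]
  have hd : (d : ℝ) + 1 ≠ 0 := by positivity
  simp [hd]

/-- The endomorphism of `V` that takes `w_i` to `p̃_i`. -/
def toPTildeLinearMap (d : ℕ) (k : Fin (d + 1) → ℕ) : V d →ₗ[ℝ] V d where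
  -- A vector x of V has the expansion ∑ (x_i/(d+1)) w_i, because its coordinates sum to 0.
  toFun x := ∑ i, (x.1 i / ((d : ℝ) + 1)) • pTilde d k i
  map_add' x y := by
    rw [← Finset.sum_add_distrib]
    refine Finset.sum_congr rfl fun i _ => ?_
    rw [← add_smul, ← add_div]
    rfl
  map_smul' c x := by
    rw [Finset.smul_sum]
    refine Finset.sum_congr rfl fun i _ => ?_
    rw [smul_smul, RingHom.id_apply, ← mul_div_assoc]
    rfl

theorem toPTildeLinearMap_apply {d : ℕ} (k : Fin (d + 1) → ℕ) (x : V d) :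
    toPTildeLinearMap d k x = ∑ i, (x.1 i / ((d : ℝ) + 1)) • pTilde d k i := rfl

/-- A discrete maximum principle: on the kernel y_j + k_j (y_j - y_{j-1}) is a constant c, so the
maximum of y is at most c and its minimum at least c. Thus y is constant, hence 0 in V. -/
theorem toPTildeLinearMap_injective (d : ℕ) (k : Fin (d + 1) → ℕ) :
    Function.Injective (toPTildeLinearMap d k) := by
  rw [← LinearMap.ker_eq_bot, LinearMap.ker_eq_bot']
  intro x hx
  have hd : (d : ℝ) + 1 ≠ 0 := by positivity
  rw [toPTildeLinearMap_apply, sum_smul_pTilde] at hx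
  set y : Fin (d + 1) → ℝ := fun i => x.1 i / ((d : ℝ) + 1) with hy
  set c := (∑ j, (y j * ((k j : ℝ) + 1) - y (j - 1) * k j)) / ((d : ℝ) + 1)
  have hc : ∀ j, y j + (k j : ℝ) * (y j - y (j - 1)) = c := fun j => by
    have h := congrArg (fun v : V d => v.1 j) hx
    rw [sum_smul_wTilde_apply] at h
    simp only [ZeroMemClass.coe_zero, Pi.zero_apply] at h
    linarith
  obtain ⟨i, hi⟩ := Finite.exists_max y
  obtain ⟨i', hi'⟩ := Finite.exists_min y
  have h1 : y i ≤ c := by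
    rw [← hc i]
    linarith [mul_nonneg (Nat.cast_nonneg (α := ℝ) (k i)) (sub_nonneg.2 (hi (i - 1)))]
  have h2 : c ≤ y i' := by
    rw [← hc i']
    have := mul_nonneg (Nat.cast_nonneg (α := ℝ) (k i')) (sub_nonneg.2 (hi' (i' - 1)))
    linarith
  have hconst : ∀ j, x.1 j = ((d : ℝ) + 1) * c := fun j => by
    have h3 : y j = c := le_antisymm ((hi j).trans h1) (h2.trans (hi' j))
    rw [← h3]
    simp only [hy]
    field_simp
  have h0 := mem_V x
  simp only [hconst, Finset.sum_const, Finset.card_univ, Fintype.card_fin, nsmul_eq_mul] at h0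
  push_cast at h0
  have hc0 : ((d : ℝ) + 1) * c = 0 := (mul_eq_zero.1 h0).resolve_left hd
  ext j
  rw [hconst, hc0]
  rfl

/-- The automorphism of `V` that takes `w_i` to `p̃_i`. -/
def toPTilde (d : ℕ) (k : Fin (d + 1) → ℕ) : V d ≃ₗ[ℝ] V d :=
  LinearEquiv.ofInjectiveEndo _ (toPTildeLinearMap_injective d k)

theorem toPTilde_apply {d : ℕ} (k : Fin (d + 1) → ℕ) (x : V d) :
    toPTilde d k x = ∑ i, (x.1 i / ((d : ℝ) + 1)) • pTilde d k i := rfl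

/-- Coefficients on the w_i are determined only up to a common constant, which is harmless because
the p̃_i sum to 0. -/
theorem toPTilde_sum_smul_w {d : ℕ} (k : Fin (d + 1) → ℕ) (a : Fin (d + 1) → ℝ) :
    toPTilde d k (∑ i, a i • w d i) = ∑ i, a i • pTilde d k i := by
  have hd : (d : ℝ) + 1 ≠ 0 := by positivity
  have h : ∀ i, (∑ i, a i • w d i : V d).1 i / ((d : ℝ) + 1) =
      a i - (∑ i, a i) / ((d : ℝ) + 1) := fun i => by
    rw [sum_smul_w_apply]
    field_simp
  have h' : ∑ i, (a i - (∑ i, a i) / ((d : ℝ) + 1)) • pTilde d k i =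
      ∑ i, (a i • pTilde d k i - ((∑ i, a i) / ((d : ℝ) + 1)) • pTilde d k i) :=
    Finset.sum_congr rfl fun i _ => sub_smul (R := ℝ) (M := V d) _ _ _
  rw [toPTilde_apply, Finset.sum_congr rfl fun i _ => by rw [h i], h', Finset.sum_sub_distrib,
    ← Finset.smul_sum, sum_pTilde, smul_zero, sub_zero]

theorem toPTilde_sum_w {d : ℕ} (k : Fin (d + 1) → ℕ) (A : Finset (Fin (d + 1))) :
    toPTilde d k (∑ a ∈ A, w d a) = ∑ a ∈ A, pTilde d k a := by
  rw [sum_w_eq_sum_smul, toPTilde_sum_smul_w]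
  simp [ite_smul]

theorem toPTilde_w {d : ℕ} (k : Fin (d + 1) → ℕ) (i : Fin (d + 1)) :
    toPTilde d k (w d i) = pTilde d k i := by
  simpa using toPTilde_sum_w k {i}

theorem toPTilde_centeredVertex {d : ℕ} (k : Fin (d + 1) → ℕ) (σ : Equiv.Perm (Fin (d + 1))) :
    toPTilde d k (centeredVertex d σ) = domainVertex d k σ := by
  have hd : (d : ℝ) + 1 ≠ 0 := by positivity
  have h : centeredVertex d σ =
      (1 / ((d : ℝ) + 1)) • ∑ i, permVertex d σ i • w d i := by
    rw [centeredVertex, Finset.smul_sum]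
    refine Finset.sum_congr rfl fun i _ => ?_
    rw [w, smul_smul, smul_smul]
    congr 1
    field_simp
  rw [h, map_smul, toPTilde_sum_smul_w, domainVertex]

theorem toPTilde_image_centeredPerm (d : ℕ) (k : Fin (d + 1) → ℕ) :
    toPTilde d k '' centeredPerm d = domain d k := by
  have h := LinearMap.image_convexHull (toPTilde d k : V d →ₗ[ℝ] V d) (Set.range (centeredVertex d))
  refine h.trans ?_
  rw [← Set.range_comp, domain]
  congr 2
  exact funext (toPTilde_centeredVertex k)

theorem toPTilde_image_centeredFacet (d : ℕ) (k : Fin (d + 1) → ℕ) (A : Finset (Fin (d + 1))) :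
    toPTilde d k '' centeredFacet d A = domainFacet d k A := by
  refine (LinearMap.image_convexHull (toPTilde d k : V d →ₗ[ℝ] V d) _).trans ?_
  rw [← Set.image_comp, domainFacet]
  congr 2
  exact funext (toPTilde_centeredVertex k)

theorem mem_sublattice_iff {d : ℕ} (k : Fin (d + 1) → ℕ) (v : V d) :
    v ∈ sublattice d k ↔ (toPTilde d k).symm v ∈ wLattice d := by
  have h : ∀ b : Fin (d + 1) → ℤ,
      ∑ j, (Matrix.vecMul b (M d k) j) • wTilde d j = ∑ i, (b i : ℝ) • pTilde d k i := fun b => by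
    simp only [pTilde, Finset.smul_sum, Matrix.vecMul, dotProduct, Finset.sum_smul]
    rw [Finset.sum_comm]
    refine Finset.sum_congr rfl fun i _ => Finset.sum_congr rfl fun j _ => ?_
    rw [mul_smul, Int.cast_smul_eq_zsmul]
  refine exists_congr fun b => ?_
  rw [h, ← toPTilde_sum_smul_w, LinearEquiv.symm_apply_eq]

/-! ### The quotient complex -/

/-- This is why sublattice translations permute the hyperplanes x_j - x_i = n, and hence the faces.
-/
theorem sublattice_sub_int {d : ℕ} {k : Fin (d + 1) → ℕ} {v : V d} (hv : v ∈ sublattice d k)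
    (i j : Fin (d + 1)) : ∃ n : ℤ, v.1 j - v.1 i = n := by
  obtain ⟨b, rfl⟩ := hv
  refine ⟨Matrix.vecMul b (M d k) j - Matrix.vecMul b (M d k) i, ?_⟩
  have h : ∑ l, Matrix.vecMul b (M d k) l • wTilde d l =
      ∑ l, ((Matrix.vecMul b (M d k) l : ℤ) : ℝ) • wTilde d l :=
    Finset.sum_congr rfl fun l _ => (Int.cast_smul_eq_zsmul ℝ _ _).symm
  rw [h, sum_smul_wTilde_apply, sum_smul_wTilde_apply]
  push_cast
  ring

theorem affineFace_add {d : ℕ} {k : Fin (d + 1) → ℕ} {v : V d} (hv : v ∈ sublattice d k)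
    (x : V d) : affineFace d (x + v) = v +ᵥ affineFace d x := by
  ext y
  rw [Set.mem_vadd_set_iff_neg_vadd_mem]
  refine forall_congr' fun i => forall_congr' fun j => imp_congr_right fun _ => ?_
  obtain ⟨n, hn⟩ := sublattice_sub_int hv i j
  have h1 : (x + v : V d).1 j - (x + v : V d).1 i = x.1 j - x.1 i + n := by
    rw [← hn]
    change x.1 j + v.1 j - (x.1 i + v.1 i) = _
    ring
  have h2 : (-v +ᵥ y : V d).1 j - (-v +ᵥ y : V d).1 i = y.1 j - y.1 i - n := by
    rw [← hn]
    change -v.1 j + y.1 j - (-v.1 i + y.1 i) = _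
    ring
  rw [h1, h2, Int.floor_add_intCast, Int.ceil_add_intCast]
  push_cast
  constructor <;> rintro ⟨h, h'⟩ <;> constructor <;> linarith

theorem self_mem_affineFace {d : ℕ} (x : V d) : x ∈ affineFace d x := fun _ _ _ =>
  ⟨Int.floor_le _, Int.le_ceil _⟩

/-- Every point lies in its own face, and a sublattice translate of a face is a face, so each orbit
pair is already a generating pair. -/
theorem torusSetoid_iff {d : ℕ} (k : Fin (d + 1) → ℕ) (x y : V d) :
    torusSetoid d k x y ↔ y - x ∈ sublattice d k := by
  constructor
  · intro h
    induction h with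
    | rel x y h =>
      obtain ⟨-, -, -, -, v, hv, -, -, rfl⟩ := h
      simpa using hv
    | refl x => simp
    | symm x y _ ih => simpa using (sublattice d k).neg_mem ih
    | trans x y z _ _ ih ih' => simpa using (sublattice d k).add_mem ih' ih
  · intro h
    exact Relation.EqvGen.rel _ _ ⟨_, ⟨x, rfl⟩, _, ⟨x + (y - x), rfl⟩, y - x, h,
      affineFace_add h x, self_mem_affineFace x, by simp⟩

/-- The map from `V` to the torus whose fibres are the orbits of the sublattice. -/
def domainToTorus (d : ℕ) (k : Fin (d + 1) → ℕ) (x : V d) : Fin d → Circle :=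
  toTorus d ((toPTilde d k).symm x).1

theorem continuous_domainToTorus (d : ℕ) (k : Fin (d + 1) → ℕ) :
    Continuous (domainToTorus d k) :=
  (continuous_toTorus d).comp (continuous_subtype_val.comp
    (LinearMap.continuous_of_finiteDimensional ((toPTilde d k).symm : V d →ₗ[ℝ] V d)))

theorem domainToTorus_eq_iff {d : ℕ} (k : Fin (d + 1) → ℕ) (x y : V d) :
    domainToTorus d k x = domainToTorus d k y ↔ y - x ∈ sublattice d k := by
  rw [domainToTorus, domainToTorus, toTorus_eq_iff, mem_sublattice_iff, map_sub]

theorem mem_domain_iff {d : ℕ} (k : Fin (d + 1) → ℕ) (x : V d) :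
    x ∈ domain d k ↔ (toPTilde d k).symm x ∈ centeredPerm d := by
  rw [← toPTilde_image_centeredPerm]
  exact (toPTilde d k).toEquiv.image_eq_preimage_symm _ ▸ Iff.rfl

theorem mem_domainFacet_iff {d : ℕ} (k : Fin (d + 1) → ℕ) (A : Finset (Fin (d + 1))) (x : V d) :
    x ∈ domainFacet d k A ↔ (toPTilde d k).symm x ∈ centeredFacet d A := by
  rw [← toPTilde_image_centeredFacet]
  exact (toPTilde d k).toEquiv.image_eq_preimage_symm _ ▸ Iff.rfl

theorem isCompact_domain (d : ℕ) (k : Fin (d + 1) → ℕ) : IsCompact (domain d k) :=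
  (Set.finite_range _).isCompact_convexHull ℝ

theorem domainShift_eq (d : ℕ) (k : Fin (d + 1) → ℕ) (A : Finset (Fin (d + 1))) :
    domainShift d k A = toPTilde d k (∑ a ∈ A, w d a) := (toPTilde_sum_w k A).symm

theorem domainShift_mem_sublattice (d : ℕ) (k : Fin (d + 1) → ℕ) (A : Finset (Fin (d + 1))) :
    domainShift d k A ∈ sublattice d k := by
  rw [mem_sublattice_iff, domainShift_eq, LinearEquiv.symm_apply_apply]
  exact sum_w_mem_wLattice A

theorem domainFacet_compl {d : ℕ} (k : Fin (d + 1) → ℕ) {A : Finset (Fin (d + 1))}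
    (hA : A.Nonempty) (hA' : A ≠ Finset.univ) :
    domainFacet d k Aᶜ = (fun x => x + domainShift d k A) '' domainFacet d k A := by
  rw [← toPTilde_image_centeredFacet, ← toPTilde_image_centeredFacet, centeredFacet_compl hA hA',
    Set.image_image, Set.image_image, domainShift_eq]
  simp only [map_add]

theorem isFundamentalDomain_domain (d : ℕ) (k : Fin (d + 1) → ℕ) :
    IsFundamentalDomain (sublattice d k) (domain d k) := by
  obtain ⟨h1, h2, h3⟩ := isFundamentalDomain_centeredPerm d
  let g := (toPTilde d k).toContinuousLinearEquiv.toHomeomorph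
  have hg : g '' centeredPerm d = domain d k := toPTilde_image_centeredPerm d k
  have hsymm : ∀ u ∈ sublattice d k, u +ᵥ domain d k =
      g '' ((toPTilde d k).symm u +ᵥ centeredPerm d) := fun u _ => by
    ext x
    rw [Set.mem_vadd_set_iff_neg_vadd_mem, mem_domain_iff, vadd_eq_add, map_add, map_neg]
    constructor
    · intro h
      exact ⟨(toPTilde d k).symm x, Set.mem_vadd_set_iff_neg_vadd_mem.2 h,
        (toPTilde d k).apply_symm_apply x⟩
    · rintro ⟨y, hy, rfl⟩
      have : (toPTilde d k).symm (g y) = y := (toPTilde d k).symm_apply_apply y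
      rw [this]
      exact Set.mem_vadd_set_iff_neg_vadd_mem.1 hy
  refine ⟨?_, fun x => ?_, fun u hu v hv huv => ?_⟩
  · rw [← hg, ← g.image_interior, ← g.image_closure, h1]
  · obtain ⟨v, hv, hxv⟩ := h2 ((toPTilde d k).symm x)
    have hv' : toPTilde d k v ∈ sublattice d k := by
      rwa [mem_sublattice_iff, LinearEquiv.symm_apply_apply]
    refine ⟨_, hv', ?_⟩
    rw [hsymm _ hv', LinearEquiv.symm_apply_apply]
    exact ⟨_, hxv, (toPTilde d k).apply_symm_apply x⟩
  · rw [hsymm u hu, hsymm v hv, ← g.image_interior, ← g.image_interior,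
      Set.disjoint_image_iff g.injective]
    exact h3 _ ((mem_sublattice_iff k u).1 hu) _ ((mem_sublattice_iff k v).1 hv)
      fun h => huv ((toPTilde d k).symm.injective h)

theorem isQuotientMap_domainToTorus_restrict (d : ℕ) (k : Fin (d + 1) → ℕ) :
    Topology.IsQuotientMap fun x : domain d k => domainToTorus d k x := by
  refine isQuotientMap_of_isCompact (isCompact_domain d k) (continuous_domainToTorus d k)
    fun θ => ?_
  obtain ⟨x, hx, h⟩ := exists_mem_centeredPerm_toTorus_eq θ
  refine ⟨toPTilde d k x, toPTilde_image_centeredPerm d k ▸ ⟨x, hx, rfl⟩, ?_⟩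
  rw [domainToTorus, LinearEquiv.symm_apply_apply, h]

theorem exists_homeomorph_gluedDomain (d : ℕ) (k : Fin (d + 1) → ℕ) :
    ∃ h : GluedDomain d k ≃ₜ (Fin d → Circle),
      ∀ x : domain d k, h (Quotient.mk _ x) = domainToTorus d k x := by
  refine exists_homeomorph_quotient _ (isQuotientMap_domainToTorus_restrict d k)
    (facetSetoid_iff (f := domainToTorus d k) (fun x A => ?_) fun x hx y hy hxy => ?_)
  · rw [eq_comm, domainToTorus_eq_iff, add_sub_cancel_left]
    exact domainShift_mem_sublattice d k A
  · rw [domainToTorus_eq_iff, mem_sublattice_iff, map_sub] at hxy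
    refine (sub_eq_zero_or_exists_facet ((mem_domain_iff k x).1 hx) ((mem_domain_iff k y).1 hy)
      hxy).imp (fun h => (toPTilde d k).symm.injective h) ?_
    rintro ⟨A, hA, hA', hxA, hyA, h⟩
    refine ⟨A, hA, hA', (mem_domainFacet_iff k A x).2 hxA, (mem_domainFacet_iff k Aᶜ y).2 hyA, ?_⟩
    rw [domainShift_eq, ← (toPTilde d k).symm.injective.eq_iff, map_add,
      LinearEquiv.symm_apply_apply, h]

theorem exists_homeomorph_torusSpace (d : ℕ) (k : Fin (d + 1) → ℕ) :
    ∃ h : TorusSpace d k ≃ₜ (Fin d → Circle),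
      ∀ x : V d, h (Quotient.mk _ x) = domainToTorus d k x :=
  exists_homeomorph_quotient _
    -- A continuous map on V is a quotient map as soon as its restriction to the compact domain is
    -- one.
    (Topology.IsQuotientMap.of_comp continuous_subtype_val (continuous_domainToTorus d k)
      (isQuotientMap_domainToTorus_restrict d k))
    fun x y => by rw [torusSetoid_iff, domainToTorus_eq_iff]

/-! ### The permutahedron itself -/

theorem permShift_eq (d : ℕ) (A : Finset (Fin (d + 1))) :
    permShift d A = (∑ a ∈ A, w d a : V d).1 := rfl

theorem addBarycenter_add {d : ℕ} (x v : V d) :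
    addBarycenter d (x + v) = addBarycenter d x + v.1 := by
  simp only [addBarycenter_apply, Submodule.coe_add, add_assoc]

theorem permFacet_compl {d : ℕ} {A : Finset (Fin (d + 1))} (hA : A.Nonempty)
    (hA' : A ≠ Finset.univ) :
    permFacet d Aᶜ = (fun x => x + permShift d A) '' permFacet d A := by
  rw [← addBarycenter_image_centeredFacet, ← addBarycenter_image_centeredFacet,
    centeredFacet_compl hA hA', Set.image_image, Set.image_image]
  simp only [addBarycenter_add, permShift_eq]

theorem permFacet_compl_eq_reflection {d : ℕ} (A : Finset (Fin (d + 1))) :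
    permFacet d Aᶜ = (fun x => (2 : ℝ) • barycenter d - x) '' permFacet d A := by
  rw [← addBarycenter_image_centeredFacet, ← addBarycenter_image_centeredFacet,
    centeredFacet_compl_eq_neg, Set.image_image, Set.image_image]
  congr 1
  funext x
  simp only [addBarycenter_apply, two_smul, NegMemClass.coe_neg]
  abel

theorem nonempty_homeomorph_gluedPerm (d : ℕ) : Nonempty (GluedPerm d ≃ₜ (Fin d → Circle)) := by
  have hcompact : IsCompact (perm d) := (Set.finite_range _).isCompact_convexHull ℝ
  have hq : Topology.IsQuotientMap fun x : perm d => toTorus d x := by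
    refine isQuotientMap_of_isCompact hcompact (continuous_toTorus d) fun θ => ?_
    obtain ⟨x, hx, rfl⟩ := exists_mem_centeredPerm_toTorus_eq θ
    exact ⟨addBarycenter d x, addBarycenter_image_centeredPerm d ▸ ⟨x, hx, rfl⟩,
      toTorus_addBarycenter x⟩
  refine ⟨(exists_homeomorph_quotient _ hq
    (facetSetoid_iff (f := toTorus d) (fun x A => ?_) fun x hx y hy hxy => ?_)).choose⟩
  · obtain ⟨m, hm⟩ := sum_w_mem_wLattice A
    funext i
    refine Circle.exp_eq_exp.2 ⟨m i.castSucc - m (Fin.last d), ?_⟩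
    simp only [permShift_eq, hm, Pi.add_apply, sum_smul_w_apply]
    push_cast
    field_simp
    ring
  · rw [← addBarycenter_image_centeredPerm] at hx hy
    obtain ⟨x, hx, rfl⟩ := hx
    obtain ⟨y, hy, rfl⟩ := hy
    rw [toTorus_addBarycenter, toTorus_addBarycenter, toTorus_eq_iff] at hxy
    refine (sub_eq_zero_or_exists_facet hx hy hxy).imp (congrArg _) ?_
    rintro ⟨A, hA, hA', hxA, hyA, h⟩
    simp only [← addBarycenter_image_centeredFacet]
    exact ⟨A, hA, hA', ⟨x, hxA, rfl⟩, ⟨y, hyA, rfl⟩, by rw [h, addBarycenter_add]; rfl⟩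

end Permutahedron

end

theorem mainTheorem7 (d : ℕ) (hd : 1 ≤ d) :
    -- `[B, A]` is opposite to `[A, B]`: it is its translate and its reflection in the barycenter
    (∀ A : Finset (Fin (d + 1)), A.Nonempty → A ≠ Finset.univ →
      Permutahedron.permFacet d Aᶜ
          = (fun x => x + Permutahedron.permShift d A) '' Permutahedron.permFacet d A ∧
      Permutahedron.permFacet d Aᶜ
          = (fun x => (2 : ℝ) • Permutahedron.barycenter d - x) ''
              Permutahedron.permFacet d A) ∧
    -- the glued permutahedron is a `d`-dimensional torus
    Nonempty (Permutahedron.GluedPerm d ≃ₜ (Fin d → Circle)) ∧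
    -- the permutahedron domain of `T_k`
    (∀ k : Fin (d + 1) → ℕ, (∀ i, 1 ≤ k i) →
      -- it is an affine image of the permutahedron, facet by facet
      (∃ g : Permutahedron.V d ≃ₗ[ℝ] Permutahedron.V d,
        (∀ i, g (Permutahedron.w d i) = Permutahedron.pTilde d k i) ∧
        (fun x : Permutahedron.V d => Permutahedron.barycenter d + (x : Fin (d + 1) → ℝ)) ''
            (g ⁻¹' Permutahedron.domain d k) = Permutahedron.perm d ∧
        ∀ A : Finset (Fin (d + 1)), A.Nonempty → A ≠ Finset.univ →
          (fun x : Permutahedron.V d => Permutahedron.barycenter d + (x : Fin (d + 1) → ℝ)) ''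
            (g ⁻¹' Permutahedron.domainFacet d k A) = Permutahedron.permFacet d A) ∧
      -- it is a fundamental domain for the translation lattice of `T_k`
      Permutahedron.IsFundamentalDomain (Permutahedron.sublattice d k)
        (Permutahedron.domain d k) ∧
      -- opposite facets differ by a lattice translation
      (∀ A : Finset (Fin (d + 1)), A.Nonempty → A ≠ Finset.univ →
        Permutahedron.domainShift d k A ∈ Permutahedron.sublattice d k ∧
        Permutahedron.domainFacet d k Aᶜ
          = (fun x => x + Permutahedron.domainShift d k A) ''
              Permutahedron.domainFacet d k A) ∧
      -- gluing opposite facets gives `T_k`, via the inclusion of the domain in `V`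
      (∃ h : Permutahedron.GluedDomain d k ≃ₜ Permutahedron.TorusSpace d k,
        ∀ x : Permutahedron.domain d k,
          h (Quotient.mk _ x) = Quotient.mk _ (x : Permutahedron.V d)) ∧
      -- and `T_k` is a `d`-dimensional torus
      Nonempty (Permutahedron.TorusSpace d k ≃ₜ (Fin d → Circle))) := by
  refine ⟨fun A hA hA' => ⟨Permutahedron.permFacet_compl hA hA',
    Permutahedron.permFacet_compl_eq_reflection A⟩,
    Permutahedron.nonempty_homeomorph_gluedPerm d, fun k _ => ⟨?_, ?_, ?_, ?_, ?_⟩⟩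
  · refine ⟨Permutahedron.toPTilde d k, Permutahedron.toPTilde_w k, ?_, fun A _ _ => ?_⟩
    · rw [← Permutahedron.toPTilde_image_centeredPerm,
        Set.preimage_image_eq _ (Permutahedron.toPTilde d k).injective]
      exact Permutahedron.addBarycenter_image_centeredPerm d
    · rw [← Permutahedron.toPTilde_image_centeredFacet,
        Set.preimage_image_eq _ (Permutahedron.toPTilde d k).injective]
      exact Permutahedron.addBarycenter_image_centeredFacet d A
  · exact Permutahedron.isFundamentalDomain_domain d k
  · exact fun A hA hA' => ⟨Permutahedron.domainShift_mem_sublattice d k A,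
      Permutahedron.domainFacet_compl k hA hA'⟩
  · obtain ⟨h₁, hh₁⟩ := Permutahedron.exists_homeomorph_gluedDomain d k
    obtain ⟨h₂, hh₂⟩ := Permutahedron.exists_homeomorph_torusSpace d k
    -- Both homeomorphisms are induced by `domainToTorus`, so the composite sends the class of x to
    -- the class of x.
    refine ⟨h₁.trans h₂.symm, fun x => ?_⟩
    rw [Homeomorph.trans_apply, hh₁, Homeomorph.symm_apply_eq, hh₂]
  · exact ⟨(Permutahedron.exists_homeomorph_torusSpace d k).choose⟩
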